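/- Let $\Lambda$ be a finite set of sites. A superfunction $F$ of the lattice variables $t_j,s_j\in\mathbb R$ and the anticommuting generators $\bar\psi_j,\psi_j$ ($j\in\Lambda$) is a function of $(t,s)\in\mathbb R^\Lambda\times\mathbb R^\Lambda$ with values in the real Grassmann algebra generated by $\{\bar\psi_j,\psi_j\}_{j\in\Lambda}$, i.e. $F=\sum_I f_I(t,s)\,\theta^I$, where $\theta^I$ runs over the monomials in the generators. $F$ is called smooth if every coefficient $f_I$ is $C^\infty$, and integrable if every $f_I$ is integrable with respect to $\prod_j (2\pi)^{-1}e^{-t_j}\,dt_j\,ds_j$. Its Berezin integral is $$\int D\mu_\Lambda\,F=\int_{(\mathbb R^2)^{|\Lambda|}}\prod_{j\in\Lambda}(2\pi)^{-1}e^{-t_j}\,dt_j\,ds_j\ \partial_{\bar\psi_j}\partial_{\psi_j}\,F ,$$ where $\partial_{\bar\psi_j},\partial_{\psi_j}$ are left derivatives. Let $Q=\sum_{j\in\Lambda}q_j$, where (index $j$ omitted) $$q=\bar\psi\,\partial_t+(\psi-s\bar\psi)\,\partial_s-s\,\partial_{\bar\psi}+\tfrac12\left(1-e^{-2t}-s^2-4\bar\psi\psi\right)\partial_\psi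 .$$ **Proposition C.1.** If $F$ is a smooth and integrable superfunction with $QF=0$, then $$\int D\mu_\Lambda\,F=F(o),$$ where $F(o)$ is the value of $F$ at the zero-field configuration $t_j=s_j=\bar\psi_j=\psi_j=0$ for all $j\in\Lambda$ (the degree-zero part of $F$ at $t=s=0$). In particular, let $\Lambda$ be the vertex set of any finite simple graph, and put $$S_{ij}=\cosh(t_i-t_j)+\tfrac12(s_i-s_j)^2e^{t_i+t_j}+(\bar\psi_i-\bar\psi_j)(\psi_i-\psi_j)\,e^{t_i+t_j},\qquad z_k=\cosh t_k+\left(\tfrac12 s_k^2+\bar\psi_k\psi_k\right)e^{t_k},$$ $$A_{\beta,\varepsilon}=\sum_{(ij)}\beta_{ij}\,(S_{ij}-1)+\sum_{k\in\Lambda}\varepsilon_k\,(z_k-1),$$ the first sum being over the edges of the graph, each counted once. Then $$Z_\Lambda(\beta,\varepsilon)=\int D\mu_\Lambda\,e^{-A_{\beta,\varepsilon}}=1$$ for all constants $\beta_{ij}=\beta\ge 0$, $\varepsilon_k=\varepsilon>0$, and more generally for all edge-dependent $\beta_{ij}\ge 0$ and site-dependent $\varepsilon_k>0$. -/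

import Mathlib

namespace H22

noncomputable section

open MeasureTheory
open scoped ContDiff

variable (Λ : Type*)

/-- The real Grassmann algebra with two anticommuting generators for each site of `Λ`. -/
abbrev Grassmann := ExteriorAlgebra ℝ (Λ ⊕ Λ → ℝ)

/-- Bosonic configurations `(t, s)`, where `t_j` and `s_j` are real for each site `j`. -/
abbrev Config := (Λ → ℝ) × (Λ → ℝ)

/-- Functions of the lattice variables `t_j, s_j, ψ̄_j, ψ_j`. -/
abbrev Superfunction := Config Λ → Grassmann Λ

variable {Λ}

section Observables

variable [DecidableEq Λ]

/-- The generator `ψ̄_j`. -/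
def psiBar (j : Λ) : Grassmann Λ := ExteriorAlgebra.ι ℝ (Pi.single (Sum.inl j) 1)

/-- The generator `ψ_j`. -/
def psi (j : Λ) : Grassmann Λ := ExteriorAlgebra.ι ℝ (Pi.single (Sum.inr j) 1)

/-- `S_ij = cosh(t_i - t_j) + ½ (s_i - s_j)² e^{t_i + t_j}
  + (ψ̄_i - ψ̄_j)(ψ_i - ψ_j) e^{t_i + t_j}`. -/
def S (i j : Λ) : Superfunction Λ := fun x =>
  algebraMap ℝ (Grassmann Λ) (Real.cosh (x.1 i - x.1 j)
      + 1 / 2 * (x.2 i - x.2 j) ^ 2 * Real.exp (x.1 i + x.1 j))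
    + Real.exp (x.1 i + x.1 j) • ((psiBar i - psiBar j) * (psi i - psi j))

/-- `S_ij` is symmetric in `i` and `j`. -/
theorem S_symm (i j : Λ) : S i j = S j i := by
  funext x
  have h1 : x.1 j - x.1 i = -(x.1 i - x.1 j) := by ring
  have h2 : (x.2 j - x.2 i) ^ 2 = (x.2 i - x.2 j) ^ 2 := by ring
  have h3 : (psiBar j - psiBar i) * (psi j - psi i)
      = (psiBar i - psiBar j) * (psi i - psi j) := by noncomm_ring
  simp only [S]
  rw [h1, h2, h3, Real.cosh_neg, add_comm (x.1 j) (x.1 i)]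

/-- `S_e` for an unordered pair `e = (ij)`. -/
def edgeS (e : Sym2 Λ) : Superfunction Λ := Sym2.lift ⟨S, S_symm⟩ e

/-- `z_k = cosh t_k + (½ s_k² + ψ̄_k ψ_k) e^{t_k}`. -/
def z (k : Λ) : Superfunction Λ := fun x =>
  algebraMap ℝ (Grassmann Λ) (Real.cosh (x.1 k) + 1 / 2 * x.2 k ^ 2 * Real.exp (x.1 k))
    + Real.exp (x.1 k) • (psiBar k * psi k)

end Observables

/-- The body (degree zero part) of an element of the Grassmann algebra. -/
def body (a : Grassmann Λ) : ℝ := ExteriorAlgebra.algebraMapInv a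

/-- The (left) derivative `∂ / ∂ψ̄_j`: the odd derivation of the Grassmann algebra that maps
`ψ̄_j` to `1` and all other generators to `0`. -/
def dPsiBar (j : Λ) : Module.End ℝ (Grassmann Λ) :=
  CliffordAlgebra.contractLeft (LinearMap.proj (Sum.inl j))

/-- The (left) derivative `∂ / ∂ψ_j`. -/
def dPsi (j : Λ) : Module.End ℝ (Grassmann Λ) :=
  CliffordAlgebra.contractLeft (LinearMap.proj (Sum.inr j))

/-- The operators `∂_{ψ̄_j} ∂_{ψ_j}` for different sites commute. -/
theorem commute_dPsiBar_dPsi (i j : Λ) :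
    Commute (dPsiBar i * dPsi i) (dPsiBar j * dPsi j) := by
  have anti : ∀ (d d' : Module.Dual ℝ (Λ ⊕ Λ → ℝ)) (x : Grassmann Λ),
      CliffordAlgebra.contractLeft d (CliffordAlgebra.contractLeft d' x) =
        -CliffordAlgebra.contractLeft d' (CliffordAlgebra.contractLeft d x) :=
    fun d d' x => CliffordAlgebra.contractLeft_comm d d' x
  refine LinearMap.ext fun x => ?_
  simp only [Module.End.mul_apply, dPsiBar, dPsi]
  rw [anti (LinearMap.proj (Sum.inr i)) (LinearMap.proj (Sum.inl j)),
    anti (LinearMap.proj (Sum.inr i)) (LinearMap.proj (Sum.inr j))]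
  simp only [map_neg, neg_neg]
  rw [anti (LinearMap.proj (Sum.inl i)) (LinearMap.proj (Sum.inl j)),
    anti (LinearMap.proj (Sum.inl i)) (LinearMap.proj (Sum.inr j))]
  simp only [map_neg, neg_neg]

variable [Fintype Λ]

/-- The basis of the Grassmann algebra formed by the monomials in the generators; the generators
are multiplied in some fixed order, which only matters for the signs of the monomials. -/
def monomialBasis : Module.Basis (Finset (Λ ⊕ Λ)) ℝ (Grassmann Λ) :=
  letI : LinearOrder (Λ ⊕ Λ) := IsWellOrder.linearOrder WellOrderingRel
  (Pi.basisFun ℝ (Λ ⊕ Λ)).ExteriorAlgebra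

/-- The coefficient functions `f_I` of `F = ∑_I f_I(t, s) · (monomial I)`. -/
def coeff (F : Superfunction Λ) (I : Finset (Λ ⊕ Λ)) : Config Λ → ℝ :=
  fun x => monomialBasis.repr (F x) I

/-- The derivative of a superfunction in the bosonic direction `v` (taken coefficientwise). -/
def pderiv (v : Config Λ) (F : Superfunction Λ) : Superfunction Λ :=
  fun x => ∑ I : Finset (Λ ⊕ Λ), lineDeriv ℝ (coeff F I) x v • monomialBasis I

/-- The density `∏_j (2π)⁻¹ e^{-t_j}` of the bosonic part of `Dμ_Λ` with respect to `dt ds`. -/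
def density (x : Config Λ) : ℝ := ∏ j, (2 * Real.pi)⁻¹ * Real.exp (-x.1 j)

/-- A superfunction is smooth if its coefficients are smooth functions of `(t, s)`. -/
def IsSmooth (F : Superfunction Λ) : Prop := ∀ I, ContDiff ℝ ∞ (coeff F I)

/-- A superfunction is integrable if all its coefficients are integrable with respect to the
measure `∏_j (2π)⁻¹ e^{-t_j} dt_j ds_j`. (Integrability of the coefficient of the top monomial
alone would be satisfied by `F = 1`, whose Berezin integral is `0`.) -/
def IsIntegrable (F : Superfunction Λ) : Prop :=
  ∀ I, Integrable (fun x => density x * coeff F I x)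

/-- The Berezin integral `∫ Dμ_Λ F` for the superintegration form
`Dμ_Λ = ∏_j (2π)⁻¹ e^{-t_j} dt_j ds_j ∂_{ψ̄_j} ∂_{ψ_j}`. -/
def superIntegral (F : Superfunction Λ) : ℝ :=
  ∫ x : Config Λ, density x *
    body (Finset.univ.noncommProd (fun j : Λ => dPsiBar j * dPsi j)
      (fun i _ j _ _ => commute_dPsiBar_dPsi i j) (F x))

variable [DecidableEq Λ]

/-- The odd first-order differential operator `Q = ∑_j q_j` in horospherical coordinates, with
`q = ψ̄ ∂_t + (ψ - s ψ̄) ∂_s - s ∂_ψ̄ + ½ (1 - e^{-2t} - s² - 4 ψ̄ ψ) ∂_ψ`. -/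
def Q (F : Superfunction Λ) : Superfunction Λ := fun x =>
  ∑ j, (psiBar j * pderiv (Pi.single j 1, 0) F x
    + (psi j - x.2 j • psiBar j) * pderiv (0, Pi.single j 1) F x
    - x.2 j • dPsiBar j (F x)
    + (1 / 2 : ℝ) • ((algebraMap ℝ (Grassmann Λ) (1 - Real.exp (-2 * x.1 j) - x.2 j ^ 2)
        - (4 : ℝ) • (psiBar j * psi j)) * dPsi j (F x)))

/-- The action `A_{β,ε} = ∑_{(ij)} β_{ij} (S_ij - 1) + ∑_k ε_k (z_k - 1)`; the first sum is over
the edges of the graph `G` (the unordered nearest neighbour pairs). -/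
def action (G : SimpleGraph Λ) [DecidableRel G.Adj] (β : Sym2 Λ → ℝ) (ε : Λ → ℝ) :
    Superfunction Λ := fun x =>
  ∑ e ∈ G.edgeFinset, β e • (edgeS e x - 1) + ∑ k, ε k • (z k x - 1)

/-- The exponential of a superfunction: if `F = b + n` with body `b` and nilpotent part `n`, then
`e^F = e^b ∑_k n^k / k!`, a finite sum. -/
def superExp (F : Superfunction Λ) : Superfunction Λ := fun x =>
  Real.exp (body (F x)) • IsNilpotent.exp (F x - algebraMap ℝ (Grassmann Λ) (body (F x)))

/-- The partition function `Z_Λ(β, ε) = ∫ Dμ_Λ e^{-A_{β,ε}}`. -/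
def partitionFunction (G : SimpleGraph Λ) [DecidableRel G.Adj] (β : Sym2 Λ → ℝ) (ε : Λ → ℝ) : ℝ :=
  superIntegral (superExp (-action G β ε))

end

end H22

/-!
The Berezin integral is localized by a family of `Q`-invariant cutoffs, which takes the place of
the deformation `F ↦ e^{-τ h} F` and needs no decay of the derivatives of `F`.

`Q` is an odd derivation (`Q_mul_apply`), and it is divergence free with respect to `Dμ`, so that
`∫ Dμ QG = 0` for smooth `G` with compact support (`superIntegral_Q`). In the embedding coordinates
`x = sinh t - (½ s² + ψ̄ψ) e^t`, `y = s e^t`, `ξ = e^t ψ̄`, `η = e^t ψ` of the superhyperboloid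
`z² = 1 + x² + y² + 2ξη`, it acts by `x ↦ ξ`, `y ↦ η`, `ξ ↦ -y`, `η ↦ x` and annihilates `z`.
Hence the bilinear expression
`S_ij = z_i z_j - x_i x_j - y_i y_j - ξ_i η_j + η_i ξ_j` is invariant (`Q_S`), and `z² - 1 = Qλ` is
exact, with `λ = xη - yξ` (`Q_lam`). The nilpotent parts of `z_k` and `S_ij` have square zero,
so a smooth function of one of them is `g(b + n) = g(b) + g'(b) n`, and it is again invariant
(`isInvariant_taylor`).

Let `QF = 0`, let `χ_R(u)` be a cutoff which equals `1` for `u ≤ 1 + R` and `0` for `u ≥ 1 + 2R`,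
and consider `I(R) = ∫ Dμ ∏_k χ_R(z_k) F`. The difference `χ_R - χ_r` is `(u² - 1) k(u)` with `k`
smooth and of bounded support on `u ≥ 1`, so changing the cutoff at one site changes the integrand
by `Q(λ k(z) ⋯ F)`, where the argument of `Q` has compact support. Therefore `I(R)` does not depend
on `R` (`superIntegral_cutoff_const`). As `R → ∞` it tends to `∫ Dμ F` by dominated convergence,
since the coefficients of the cutoff are bounded uniformly in `R`
(`tendsto_superIntegral_cutoff_atTop`). For `R = ε² → 0` the configuration is rescaled to `ε y`;
only the term with all the factors `ψ̄_k ψ_k` coming from the cutoff survives, and what remains is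
`F(o)` times a product of integrals `-(2π)⁻¹ ∫ χ₁'(1 + |p|²/2) dp = 1` over the plane
(`tendsto_superIntegral_cutoff_zero`).

For the partition function, `e^{-A}` is a product of functions of the invariants `S_ij` and `z_k`,
hence invariant, and its body at the zero field is `1`. It is integrable because the body of `z_k`
controls `e^{±t_k}` and `|s_k|`, so that the decay of `e^{-ε_k z_k}` compensates the density and
every polynomial in these quantities (`isIntegrable_of_isModerate`).
-/

namespace H22

noncomputable section

open MeasureTheory Filter Topology Asymptotics
open scoped ContDiff

/-! ### The Grassmann algebra -/

section Algebra

variable {Λ : Type*}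

/-- The parity automorphism of the Grassmann algebra, which changes the sign of all generators. -/
def parity : Grassmann Λ →ₐ[ℝ] Grassmann Λ := CliffordAlgebra.involute

@[simp]
theorem parity_ι (v : Λ ⊕ Λ → ℝ) :
    parity (ExteriorAlgebra.ι ℝ v) = -(ExteriorAlgebra.ι ℝ v : Grassmann Λ) :=
  CliffordAlgebra.involute_ι v

theorem ι_mul_ι_comm (v w : Λ ⊕ Λ → ℝ) :
    (ExteriorAlgebra.ι ℝ v * ExteriorAlgebra.ι ℝ w : Grassmann Λ)
      = -(ExteriorAlgebra.ι ℝ w * ExteriorAlgebra.ι ℝ v) :=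
  eq_neg_of_add_eq_zero_left (ExteriorAlgebra.ι_add_mul_swap v w)

theorem ι_mul_eq_parity_mul (v : Λ ⊕ Λ → ℝ) (a : Grassmann Λ) :
    ExteriorAlgebra.ι ℝ v * a = parity a * ExteriorAlgebra.ι ℝ v := by
  induction a using ExteriorAlgebra.induction with
  | algebraMap r => rw [AlgHom.commutes, Algebra.commutes]
  | ι w => rw [parity_ι, neg_mul, ι_mul_ι_comm]
  | mul a b ha hb => rw [← mul_assoc, ha, mul_assoc, hb, map_mul, mul_assoc]
  | add a b ha hb => rw [mul_add, ha, hb, map_add, add_mul]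

/-- Even elements of the Grassmann algebra are central. -/
theorem mul_comm_of_even {a : Grassmann Λ} (ha : parity a = a) (b : Grassmann Λ) :
    a * b = b * a := by
  induction b using ExteriorAlgebra.induction with
  | algebraMap r => rw [Algebra.commutes]
  | ι v => rw [ι_mul_eq_parity_mul, ha]
  | mul b c hb hc => rw [← mul_assoc, hb, mul_assoc, hc, mul_assoc]
  | add b c hb hc => rw [mul_add, hb, hc, add_mul]

/-- The contractions with linear forms are odd derivations of the Grassmann algebra. -/
theorem contractLeft_mul (d : Module.Dual ℝ (Λ ⊕ Λ → ℝ)) (a b : Grassmann Λ) :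
    CliffordAlgebra.contractLeft d (a * b)
      = CliffordAlgebra.contractLeft d a * b + parity a * CliffordAlgebra.contractLeft d b := by
  revert b
  induction a using CliffordAlgebra.left_induction with
  | algebraMap r =>
    intro b
    rw [CliffordAlgebra.contractLeft_algebraMap_mul, CliffordAlgebra.contractLeft_algebraMap,
      zero_mul, zero_add]
    congr 1
    exact (AlgHom.commutes parity r).symm
  | add x y hx hy =>
    intro b
    rw [add_mul, map_add, hx, hy, map_add, map_add, add_mul, add_mul]
    abel
  | ι_mul x v hx =>
    intro b
    have h : parity (CliffordAlgebra.ι 0 v * x : Grassmann Λ)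
        = -(CliffordAlgebra.ι 0 v * parity x) := by
      rw [map_mul, ← neg_mul]
      congr 1
      exact parity_ι v
    rw [h, mul_assoc, CliffordAlgebra.contractLeft_ι_mul, CliffordAlgebra.contractLeft_ι_mul, hx]
    simp only [sub_mul, smul_mul_assoc, mul_add, neg_mul, mul_assoc]
    abel

variable (Λ) in
/-- The subalgebra of even elements of the Grassmann algebra. -/
def evenPart : Subalgebra ℝ (Grassmann Λ) := AlgHom.equalizer parity (AlgHom.id ℝ _)

theorem mem_evenPart {a : Grassmann Λ} : a ∈ evenPart Λ ↔ parity a = a := Iff.rfl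

instance : CommRing (evenPart Λ) :=
  { (inferInstance : Ring (evenPart Λ)) with
    mul_comm := fun a b => Subtype.ext (mul_comm_of_even a.2 b) }

@[simp]
theorem parity_coe_even (a : evenPart Λ) : parity (a : Grassmann Λ) = a := a.2

theorem even_coe_comm (a : evenPart Λ) (b : Grassmann Λ) : (a : Grassmann Λ) * b = b * a :=
  mul_comm_of_even a.2 b

theorem coe_smul_mul (c : ℝ) (a : evenPart Λ) (b : Grassmann Λ) :
    ((c • a : evenPart Λ) : Grassmann Λ) * b = c • ((a : Grassmann Λ) * b) :=
  smul_mul_assoc c (a : Grassmann Λ) b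

/-- The product of two generators, as an even element. -/
def bilin (v w : Λ ⊕ Λ → ℝ) : evenPart Λ :=
  ⟨ExteriorAlgebra.ι ℝ v * ExteriorAlgebra.ι ℝ w, by
    rw [mem_evenPart, map_mul, parity_ι, parity_ι, neg_mul_neg]⟩

theorem bilin_mul_self (v w : Λ ⊕ Λ → ℝ) : bilin v w * bilin v w = 0 := by
  apply Subtype.ext
  change (ExteriorAlgebra.ι ℝ v * ExteriorAlgebra.ι ℝ w) *
    (ExteriorAlgebra.ι ℝ v * ExteriorAlgebra.ι ℝ w) = (0 : Grassmann Λ)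
  rw [mul_assoc, ← mul_assoc (ExteriorAlgebra.ι ℝ w), ι_mul_ι_comm w v, neg_mul, mul_neg,
    ← mul_assoc, ← mul_assoc, ExteriorAlgebra.ι_sq_zero]
  simp

theorem body_mul (a b : Grassmann Λ) : body (a * b) = body a * body b :=
  map_mul ExteriorAlgebra.algebraMapInv a b

theorem body_add (a b : Grassmann Λ) : body (a + b) = body a + body b :=
  map_add ExteriorAlgebra.algebraMapInv a b

theorem body_smul (r : ℝ) (a : Grassmann Λ) : body (r • a) = r * body a :=
  map_smul ExteriorAlgebra.algebraMapInv r a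

@[simp]
theorem body_algebraMap (r : ℝ) : body (algebraMap ℝ (Grassmann Λ) r) = r :=
  AlgHom.commutes ExteriorAlgebra.algebraMapInv r

@[simp]
theorem body_ι (v : Λ ⊕ Λ → ℝ) : body (ExteriorAlgebra.ι ℝ v : Grassmann Λ) = 0 := by
  simp [body, ExteriorAlgebra.algebraMapInv]

theorem body_ι_mul (v : Λ ⊕ Λ → ℝ) (a : Grassmann Λ) :
    body (ExteriorAlgebra.ι ℝ v * a) = 0 := by
  rw [body_mul, body_ι, zero_mul]

theorem body_bilin (v w : Λ ⊕ Λ → ℝ) : body (bilin v w : Grassmann Λ) = 0 :=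
  body_ι_mul _ _

/-- Taking the body, as a linear form. -/
def bodyL : Grassmann Λ →ₗ[ℝ] ℝ := ExteriorAlgebra.algebraMapInv.toLinearMap

end Algebra

/-! ### The fermionic part of the Berezin integral -/

section Berezin

variable {Λ : Type*}

theorem dPsiBar_mul (j : Λ) (a b : Grassmann Λ) :
    dPsiBar j (a * b) = dPsiBar j a * b + parity a * dPsiBar j b := contractLeft_mul _ a b

theorem dPsi_mul (j : Λ) (a b : Grassmann Λ) :
    dPsi j (a * b) = dPsi j a * b + parity a * dPsi j b := contractLeft_mul _ a b

theorem dPsiBar_algebraMap (j : Λ) (r : ℝ) : dPsiBar j (algebraMap ℝ (Grassmann Λ) r) = 0 :=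
  CliffordAlgebra.contractLeft_algebraMap (0 : QuadraticForm ℝ (Λ ⊕ Λ → ℝ)) _ r

theorem dPsi_algebraMap (j : Λ) (r : ℝ) : dPsi j (algebraMap ℝ (Grassmann Λ) r) = 0 :=
  CliffordAlgebra.contractLeft_algebraMap (0 : QuadraticForm ℝ (Λ ⊕ Λ → ℝ)) _ r

theorem dPsiBar_ι (j : Λ) (v : Λ ⊕ Λ → ℝ) :
    dPsiBar j (ExteriorAlgebra.ι ℝ v) = algebraMap ℝ (Grassmann Λ) (v (Sum.inl j)) :=
  CliffordAlgebra.contractLeft_ι (0 : QuadraticForm ℝ (Λ ⊕ Λ → ℝ)) (LinearMap.proj (Sum.inl j)) v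

theorem dPsi_ι (j : Λ) (v : Λ ⊕ Λ → ℝ) :
    dPsi j (ExteriorAlgebra.ι ℝ v) = algebraMap ℝ (Grassmann Λ) (v (Sum.inr j)) :=
  CliffordAlgebra.contractLeft_ι (0 : QuadraticForm ℝ (Λ ⊕ Λ → ℝ)) (LinearMap.proj (Sum.inr j)) v

theorem pairwise_commute_dPsiBar_dPsi (A : Finset Λ) :
    (A : Set Λ).Pairwise (Function.onFun Commute fun j : Λ => dPsiBar j * dPsi j) :=
  fun i _ j _ _ => commute_dPsiBar_dPsi i j

/-- The product of the operators `∂_{ψ̄_j} ∂_{ψ_j}` over the sites of a finite set. -/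
def topDeriv (A : Finset Λ) : Module.End ℝ (Grassmann Λ) :=
  A.noncommProd (fun j : Λ => dPsiBar j * dPsi j) (pairwise_commute_dPsiBar_dPsi A)

theorem topDeriv_empty (a : Grassmann Λ) : topDeriv ∅ a = a := by
  rw [topDeriv, Finset.noncommProd_empty, Module.End.one_apply]

/-- The fermionic part of the Berezin integral: the body of `∏_j ∂_{ψ̄_j} ∂_{ψ_j} a`. -/
def berezin [Fintype Λ] : Grassmann Λ →ₗ[ℝ] ℝ := bodyL ∘ₗ topDeriv Finset.univ

theorem superIntegral_eq [Fintype Λ] (F : Superfunction Λ) :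
    superIntegral F = ∫ x : Config Λ, density x * berezin (F x) := rfl

variable [DecidableEq Λ]

/-- The bilinear `ψ̄_j ψ_j`, as an even element. -/
def nu (j : Λ) : evenPart Λ := bilin (Pi.single (Sum.inl j) 1) (Pi.single (Sum.inr j) 1)

theorem coe_nu (j : Λ) : (nu j : Grassmann Λ) = psiBar j * psi j := rfl

theorem parity_psiBar (j : Λ) : parity (psiBar j) = -psiBar j := parity_ι _

theorem parity_psi (j : Λ) : parity (psi j) = -psi j := parity_ι _

theorem psiBar_mul_self (j : Λ) : psiBar j * psiBar j = 0 := ExteriorAlgebra.ι_sq_zero _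

theorem dPsiBar_psiBar (i j : Λ) : dPsiBar i (psiBar j) = if i = j then 1 else 0 := by
  rw [psiBar, dPsiBar_ι, Pi.single_apply]
  simp only [Sum.inl.injEq]
  split_ifs <;> simp

theorem dPsiBar_psi (i j : Λ) : dPsiBar i (psi j) = 0 := by
  rw [psi, dPsiBar_ι, Pi.single_apply]
  simp

theorem dPsi_psiBar (i j : Λ) : dPsi i (psiBar j) = 0 := by
  rw [psiBar, dPsi_ι, Pi.single_apply]
  simp

theorem dPsi_psi (i j : Λ) : dPsi i (psi j) = if i = j then 1 else 0 := by
  rw [psi, dPsi_ι, Pi.single_apply]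
  simp only [Sum.inr.injEq]
  split_ifs <;> simp

theorem dPsi_psiBar_mul (i j : Λ) (a : Grassmann Λ) :
    dPsi i (psiBar j * a) = -(psiBar j * dPsi i a) := by
  rw [dPsi_mul, dPsi_psiBar, parity_psiBar, zero_mul, zero_add, neg_mul]

theorem dPsiBar_psi_mul (i j : Λ) (a : Grassmann Λ) :
    dPsiBar i (psi j * a) = -(psi j * dPsiBar i a) := by
  rw [dPsiBar_mul, dPsiBar_psi, parity_psi, zero_mul, zero_add, neg_mul]

theorem dPsi_psi_mul (j : Λ) (a : Grassmann Λ) :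
    dPsi j (psi j * a) = a - psi j * dPsi j a := by
  rw [dPsi_mul, dPsi_psi, parity_psi, if_pos rfl, one_mul, neg_mul, sub_eq_add_neg]

theorem dPsiBar_psiBar_mul (j : Λ) (a : Grassmann Λ) :
    dPsiBar j (psiBar j * a) = a - psiBar j * dPsiBar j a := by
  rw [dPsiBar_mul, dPsiBar_psiBar, parity_psiBar, if_pos rfl, one_mul, neg_mul, sub_eq_add_neg]

theorem dPsi_psi_mul_of_ne {i j : Λ} (h : i ≠ j) (a : Grassmann Λ) :
    dPsi i (psi j * a) = -(psi j * dPsi i a) := by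
  rw [dPsi_mul, dPsi_psi, parity_psi, if_neg h, zero_mul, zero_add, neg_mul]

theorem dPsiBar_psiBar_mul_of_ne {i j : Λ} (h : i ≠ j) (a : Grassmann Λ) :
    dPsiBar i (psiBar j * a) = -(psiBar j * dPsiBar i a) := by
  rw [dPsiBar_mul, dPsiBar_psiBar, parity_psiBar, if_neg h, zero_mul, zero_add, neg_mul]

theorem topDeriv_insert {A : Finset Λ} {j : Λ} (hj : j ∉ A) (a : Grassmann Λ) :
    topDeriv (insert j A) a = topDeriv A (dPsiBar j (dPsi j a)) := by
  rw [topDeriv, Finset.noncommProd_insert_of_notMem' _ _ _ _ hj]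
  rfl

theorem topDeriv_of_mem {A : Finset Λ} {j : Λ} (hj : j ∈ A) (a : Grassmann Λ) :
    topDeriv A a = topDeriv (A.erase j) (dPsiBar j (dPsi j a)) := by
  rw [← topDeriv_insert (Finset.notMem_erase j A), Finset.insert_erase hj]

theorem topDeriv_dPsi {A : Finset Λ} {j : Λ} (hj : j ∈ A) (a : Grassmann Λ) :
    topDeriv A (dPsi j a) = 0 := by
  have h : dPsi j (dPsi j a) = 0 := CliffordAlgebra.contractLeft_contractLeft _ a
  rw [topDeriv_of_mem hj, h, map_zero, map_zero]

theorem topDeriv_dPsiBar {A : Finset Λ} {j : Λ} (hj : j ∈ A) (a : Grassmann Λ) :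
    topDeriv A (dPsiBar j a) = 0 := by
  have h : dPsi j (dPsiBar j a) = -dPsiBar j (dPsi j a) :=
    CliffordAlgebra.contractLeft_comm _ _ a
  have h' : dPsiBar j (dPsiBar j (dPsi j a)) = 0 :=
    CliffordAlgebra.contractLeft_contractLeft _ _
  rw [topDeriv_of_mem hj, h, map_neg, h', neg_zero, map_zero]

theorem topDeriv_psiBar_mul {A : Finset Λ} {j : Λ} (hj : j ∉ A) (a : Grassmann Λ) :
    topDeriv A (psiBar j * a) = psiBar j * topDeriv A a := by
  induction A using Finset.induction_on generalizing a with
  | empty => rw [topDeriv_empty, topDeriv_empty]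
  | insert i A hi ih =>
    have hij : i ≠ j := fun h => hj (h ▸ Finset.mem_insert_self i A)
    rw [topDeriv_insert hi, topDeriv_insert hi, dPsi_psiBar_mul, map_neg,
      dPsiBar_psiBar_mul_of_ne hij, neg_neg, ih fun h => hj (Finset.mem_insert_of_mem h)]

theorem topDeriv_psi_mul {A : Finset Λ} {j : Λ} (hj : j ∉ A) (a : Grassmann Λ) :
    topDeriv A (psi j * a) = psi j * topDeriv A a := by
  induction A using Finset.induction_on generalizing a with
  | empty => rw [topDeriv_empty, topDeriv_empty]
  | insert i A hi ih =>
    have hij : i ≠ j := fun h => hj (h ▸ Finset.mem_insert_self i A)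
    rw [topDeriv_insert hi, topDeriv_insert hi, dPsi_psi_mul_of_ne hij, map_neg,
      dPsiBar_psi_mul, neg_neg, ih fun h => hj (Finset.mem_insert_of_mem h)]

/-- Each factor `ψ̄_j ψ_j` is removed by `∂_{ψ̄_j} ∂_{ψ_j}` at the cost of a sign; the other terms
keep a factor `ψ̄_j` or `ψ_j` and have no body. -/
theorem body_topDeriv_prod_nu_mul (A : Finset Λ) (a : Grassmann Λ) :
    body (topDeriv A (((∏ j ∈ A, nu j : evenPart Λ) : Grassmann Λ) * a))
      = (-1) ^ A.card * body a := by
  induction A using Finset.induction_on generalizing a with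
  | empty => simp [topDeriv_empty]
  | insert j A hj ih =>
    set b : Grassmann Λ := ((∏ i ∈ A, nu i : evenPart Λ) : Grassmann Λ) * a with hb
    have h1 : ((∏ i ∈ insert j A, nu i : evenPart Λ) : Grassmann Λ) * a
        = psiBar j * (psi j * b) := by
      rw [Finset.prod_insert hj, hb, ← mul_assoc, ← mul_assoc, ← coe_nu]
      rfl
    have h2 : dPsiBar j (dPsi j (psiBar j * (psi j * b)))
        = -b + (psiBar j * dPsiBar j b
          + (psi j * dPsi j b - psiBar j * dPsiBar j (psi j * dPsi j b))) := by
      rw [dPsi_psiBar_mul, dPsi_psi_mul, map_neg, dPsiBar_psiBar_mul, map_sub, mul_sub]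
      abel
    rw [h1, topDeriv_insert hj, h2, map_add, map_add, map_sub, map_neg, topDeriv_psiBar_mul hj,
      topDeriv_psiBar_mul hj, topDeriv_psi_mul hj, body_add, body_add]
    have h3 : ∀ c d : Grassmann Λ, body (psi j * c - psiBar j * d) = 0 := fun c d => by
      rw [sub_eq_add_neg, ← neg_one_smul ℝ, body_add, body_smul, psi, psiBar, body_ι_mul,
        body_ι_mul]
      simp
    have h4 : ∀ c : Grassmann Λ, body (psiBar j * c) = 0 := fun c => body_ι_mul _ c
    rw [h3, h4, ← neg_one_smul ℝ, body_smul, ih, Finset.card_insert_of_notMem hj]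
    ring

variable [Fintype Λ]

theorem berezin_dPsi (j : Λ) (a : Grassmann Λ) : berezin (dPsi j a) = 0 := by
  rw [berezin, LinearMap.comp_apply, topDeriv_dPsi (Finset.mem_univ j), map_zero]

theorem berezin_dPsiBar (j : Λ) (a : Grassmann Λ) : berezin (dPsiBar j a) = 0 := by
  rw [berezin, LinearMap.comp_apply, topDeriv_dPsiBar (Finset.mem_univ j), map_zero]

/-- Fermionic integration by parts for the nonlinear part of `Q`. -/
theorem berezin_nu_mul_dPsi (j : Λ) (a : Grassmann Λ) :
    berezin (psiBar j * psi j * dPsi j a) = berezin (psiBar j * a) := by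
  have h : psiBar j * psi j * dPsi j a = psiBar j * a + dPsi j (psiBar j * (psi j * a)) := by
    rw [dPsi_psiBar_mul, dPsi_psi_mul, mul_sub, mul_assoc]
    abel
  rw [h, map_add, berezin_dPsi, add_zero]

theorem berezin_prod_nu_mul (a : Grassmann Λ) :
    berezin (((∏ j, nu j : evenPart Λ) : Grassmann Λ) * a)
      = (-1) ^ Fintype.card Λ * body a :=
  body_topDeriv_prod_nu_mul Finset.univ a

end Berezin

/-! ### Calculus of superfunctions -/

section Calculus

variable {Λ : Type*} [Fintype Λ]

theorem apply_eq_sum_coeff (l : Grassmann Λ →ₗ[ℝ] ℝ) (F : Superfunction Λ) (x : Config Λ) :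
    l (F x) = ∑ I, coeff F I x * l (monomialBasis I) := by
  conv_lhs => rw [← monomialBasis.sum_repr (F x)]
  rw [map_sum]
  exact Finset.sum_congr rfl fun I _ => by rw [map_smul, smul_eq_mul]; rfl

theorem IsSmooth.contDiff {F : Superfunction Λ} (hF : IsSmooth F) (l : Grassmann Λ →ₗ[ℝ] ℝ) :
    ContDiff ℝ ∞ fun x => l (F x) := by
  simp_rw [apply_eq_sum_coeff l F]
  exact ContDiff.sum fun I _ => (hF I).mul contDiff_const

theorem isSmooth_iff {F : Superfunction Λ} :
    IsSmooth F ↔ ∀ l : Grassmann Λ →ₗ[ℝ] ℝ, ContDiff ℝ ∞ fun x => l (F x) :=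
  ⟨fun h l => h.contDiff l, fun h I => h (monomialBasis.coord I)⟩

theorem isSmooth_const (a : Grassmann Λ) : IsSmooth (fun _ : Config Λ => a) :=
  fun _ => contDiff_const

theorem IsSmooth.add {F G : Superfunction Λ} (hF : IsSmooth F) (hG : IsSmooth G) :
    IsSmooth (F + G) := isSmooth_iff.2 fun l => by
  simp_rw [Pi.add_apply, map_add]
  exact (hF.contDiff l).add (hG.contDiff l)

theorem IsSmooth.neg {F : Superfunction Λ} (hF : IsSmooth F) : IsSmooth (-F) :=
  isSmooth_iff.2 fun l => by
    simp_rw [Pi.neg_apply, map_neg]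
    exact (hF.contDiff l).neg

theorem IsSmooth.sub {F G : Superfunction Λ} (hF : IsSmooth F) (hG : IsSmooth G) :
    IsSmooth (F - G) := sub_eq_add_neg F G ▸ hF.add hG.neg

theorem IsSmooth.smul {F : Superfunction Λ} (hF : IsSmooth F) {f : Config Λ → ℝ}
    (hf : ContDiff ℝ ∞ f) : IsSmooth (fun x => f x • F x) := isSmooth_iff.2 fun l => by
  simp_rw [map_smul]
  exact hf.smul (hF.contDiff l)

theorem IsSmooth.const_smul {F : Superfunction Λ} (hF : IsSmooth F) (r : ℝ) : IsSmooth (r • F) :=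
  hF.smul contDiff_const

theorem isSmooth_algebraMap {f : Config Λ → ℝ} (hf : ContDiff ℝ ∞ f) :
    IsSmooth (fun x => algebraMap ℝ (Grassmann Λ) (f x)) := by
  simp_rw [Algebra.algebraMap_eq_smul_one]
  exact (isSmooth_const 1).smul hf

/-- The coefficients of a product are bilinear in the coefficients of the factors. -/
theorem apply_mul_eq_sum (l : Grassmann Λ →ₗ[ℝ] ℝ) (a b : Grassmann Λ) :
    l (a * b) = ∑ I, ∑ J, monomialBasis.coord I a * monomialBasis.coord J b
      * l (monomialBasis I * monomialBasis J) := by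
  conv_lhs => rw [← monomialBasis.sum_repr a, ← monomialBasis.sum_repr b, Finset.sum_mul_sum]
  simp only [map_sum, smul_mul_smul_comm, map_smul, smul_eq_mul]
  rfl

theorem IsSmooth.mul {F G : Superfunction Λ} (hF : IsSmooth F) (hG : IsSmooth G) :
    IsSmooth (F * G) := isSmooth_iff.2 fun l => by
  have h : (fun x => l ((F * G) x)) = _ := funext fun x => apply_mul_eq_sum l (F x) (G x)
  rw [h]
  exact ContDiff.sum fun I _ => ContDiff.sum fun J _ =>
    ((hF.contDiff _).mul (hG.contDiff _)).mul contDiff_const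

theorem IsSmooth.hasLineDerivAt {F : Superfunction Λ} (hF : IsSmooth F)
    (l : Grassmann Λ →ₗ[ℝ] ℝ) (x v : Config Λ) :
    HasLineDerivAt ℝ (fun y => l (F y)) (l (pderiv v F x)) x v := by
  have h : l (pderiv v F x) = ∑ I, lineDeriv ℝ (coeff F I) x v * l (monomialBasis I) := by
    rw [pderiv, map_sum]
    exact Finset.sum_congr rfl fun I _ => by rw [map_smul, smul_eq_mul]
  rw [h]
  simp_rw [apply_eq_sum_coeff l F]
  refine HasDerivAt.fun_sum fun I _ => HasDerivAt.mul_const ?_ _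
  exact (((hF I).differentiable (by simp)) x).lineDifferentiableAt.hasLineDerivAt

/-- A derivative of a superfunction may be computed through linear forms. -/
theorem pderiv_eq_of_forall {F : Superfunction Λ} {a : Grassmann Λ} {x v : Config Λ}
    (h : ∀ l : Grassmann Λ →ₗ[ℝ] ℝ, HasLineDerivAt ℝ (fun y => l (F y)) (l a) x v) :
    pderiv v F x = a := by
  rw [pderiv]
  conv_rhs => rw [← monomialBasis.sum_repr a]
  exact Finset.sum_congr rfl fun I _ => by
    exact congrArg (· • monomialBasis I) (h (monomialBasis.coord I)).lineDeriv

theorem pderiv_add {F G : Superfunction Λ} (hF : IsSmooth F) (hG : IsSmooth G)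
    (x v : Config Λ) : pderiv v (F + G) x = pderiv v F x + pderiv v G x :=
  pderiv_eq_of_forall fun l => by
    simp_rw [Pi.add_apply, map_add]
    exact HasDerivAt.add (hF.hasLineDerivAt l x v) (hG.hasLineDerivAt l x v)

theorem pderiv_const (a : Grassmann Λ) (x v : Config Λ) :
    pderiv v (fun _ : Config Λ => a) x = 0 :=
  pderiv_eq_of_forall fun l => by
    rw [map_zero]
    exact hasDerivAt_const _ _

theorem pderiv_algebraMap {f : Config Λ → ℝ} {f' : ℝ} {x v : Config Λ}
    (hf : HasLineDerivAt ℝ f f' x v) :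
    pderiv v (fun y => algebraMap ℝ (Grassmann Λ) (f y)) x = algebraMap ℝ (Grassmann Λ) f' :=
  pderiv_eq_of_forall fun l => by
    simp_rw [Algebra.algebraMap_eq_smul_one, map_smul]
    exact HasDerivAt.smul_const hf _

theorem pderiv_mul {F G : Superfunction Λ} (hF : IsSmooth F) (hG : IsSmooth G)
    (x v : Config Λ) : pderiv v (F * G) x = pderiv v F x * G x + F x * pderiv v G x :=
  pderiv_eq_of_forall fun l => by
    rw [map_add, apply_mul_eq_sum l (pderiv v F x), apply_mul_eq_sum l (F x)]
    have h : (fun y => l ((F * G) y)) = _ := funext fun y => apply_mul_eq_sum l (F y) (G y)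
    rw [h, ← Finset.sum_add_distrib]
    refine HasDerivAt.fun_sum fun I _ => ?_
    rw [← Finset.sum_add_distrib]
    refine HasDerivAt.fun_sum fun J _ => ?_
    rw [← add_mul]
    have h := HasDerivAt.mul (hF.hasLineDerivAt (monomialBasis.coord I) x v)
      (hG.hasLineDerivAt (monomialBasis.coord J) x v)
    simp only [zero_smul, add_zero] at h
    exact h.mul_const _

end Calculus

/-! ### The supersymmetry `Q` as an odd derivation -/

section Supersymmetry

variable {Λ : Type*}

/-- A superfunction is even if it takes values in the even part of the Grassmann algebra. -/
def IsEven (F : Superfunction Λ) : Prop := ∀ x, parity (F x) = F x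

/-- A superfunction is odd if the parity automorphism changes the sign of its values. -/
def IsOdd (F : Superfunction Λ) : Prop := ∀ x, parity (F x) = -F x

theorem IsEven.mul {F G : Superfunction Λ} (hF : IsEven F) (hG : IsEven G) : IsEven (F * G) :=
  fun x => by rw [Pi.mul_apply, map_mul, hF, hG]

theorem IsEven.mul_odd {F G : Superfunction Λ} (hF : IsEven F) (hG : IsOdd G) : IsOdd (F * G) :=
  fun x => by rw [Pi.mul_apply, map_mul, hF, hG, mul_neg]

theorem IsEven.sub {F G : Superfunction Λ} (hF : IsEven F) (hG : IsEven G) : IsEven (F - G) :=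
  fun x => by rw [Pi.sub_apply, map_sub, hF, hG]

theorem IsOdd.sub {F G : Superfunction Λ} (hF : IsOdd F) (hG : IsOdd G) : IsOdd (F - G) :=
  fun x => by rw [Pi.sub_apply, map_sub, hF, hG, neg_sub_neg, neg_sub]

theorem isEven_algebraMap (f : Config Λ → ℝ) :
    IsEven (fun x => algebraMap ℝ (Grassmann Λ) (f x)) := fun _ => AlgHom.commutes _ _

theorem IsEven.mul_comm {F : Superfunction Λ} (hF : IsEven F) (G : Superfunction Λ) :
    F * G = G * F := funext fun x => mul_comm_of_even (hF x) (G x)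

variable [DecidableEq Λ]

/-- The coefficient function `½ (1 - e^{-2t} - s² - 4 ψ̄ ψ)` of `∂_ψ` in `Q` is even. -/
theorem parity_coeff_dPsi (j : Λ) (r : ℝ) :
    parity (algebraMap ℝ (Grassmann Λ) r - (4 : ℝ) • (psiBar j * psi j))
      = algebraMap ℝ (Grassmann Λ) r - (4 : ℝ) • (psiBar j * psi j) := by
  rw [map_sub, map_smul, AlgHom.commutes, map_mul, parity_psiBar, parity_psi, neg_mul_neg]

theorem psiBar_mul_eq (j : Λ) (a : Grassmann Λ) : psiBar j * a = parity a * psiBar j :=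
  ι_mul_eq_parity_mul _ a

theorem psi_mul_eq (j : Λ) (a : Grassmann Λ) : psi j * a = parity a * psi j :=
  ι_mul_eq_parity_mul _ a

variable [Fintype Λ]

theorem Q_add {F G : Superfunction Λ} (hF : IsSmooth F) (hG : IsSmooth G) :
    Q (F + G) = Q F + Q G := by
  funext x
  rw [Pi.add_apply, Q, Q, Q, ← Finset.sum_add_distrib]
  refine Finset.sum_congr rfl fun j _ => ?_
  rw [pderiv_add hF hG, pderiv_add hF hG, Pi.add_apply, map_add, map_add]
  simp only [mul_add, smul_add]
  abel

/-- The contribution of one site to the graded Leibniz rule for `Q`: `b` and `p` are the odd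
generators, `c` is the even coefficient of `∂_ψ`, and `f'` is the image of `f` under the parity
automorphism. -/
theorem leibniz_site {A : Type*} [Ring A] [Algebra ℝ A] {b p c f f' g ft fs fb fp gt gs gb gp : A}
    (s : ℝ) (hb : b * f = f' * b) (hp : p * f = f' * p) (hc : c * f' = f' * c) :
    b * (ft * g + f * gt) + (p - s • b) * (fs * g + f * gs) - s • (fb * g + f' * gb)
        + (1 / 2 : ℝ) • (c * (fp * g + f' * gp))
      = (b * ft + (p - s • b) * fs - s • fb + (1 / 2 : ℝ) • (c * fp)) * g
        + f' * (b * gt + (p - s • b) * gs - s • gb + (1 / 2 : ℝ) • (c * gp)) := by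
  have hq : (p - s • b) * f = f' * (p - s • b) := by
    rw [sub_mul, mul_sub, hp, smul_mul_assoc, hb, mul_smul_comm]
  have e1 : b * (ft * g + f * gt) = b * ft * g + f' * (b * gt) := by
    rw [mul_add, ← mul_assoc, ← mul_assoc, hb, mul_assoc f']
  have e2 : (p - s • b) * (fs * g + f * gs) = (p - s • b) * fs * g + f' * ((p - s • b) * gs) := by
    rw [mul_add, ← mul_assoc, ← mul_assoc, hq, mul_assoc f']
  have e3 : c * (fp * g + f' * gp) = c * fp * g + f' * (c * gp) := by
    rw [mul_add, ← mul_assoc, ← mul_assoc, hc, mul_assoc f']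
  rw [e1, e2, e3]
  simp only [mul_add f', mul_sub f', add_mul _ _ g, sub_mul _ _ g, smul_mul_assoc, mul_smul_comm,
    smul_add]
  abel

/-- The graded Leibniz rule for `Q`. -/
theorem Q_mul_apply {F G : Superfunction Λ} (hF : IsSmooth F) (hG : IsSmooth G) (x : Config Λ) :
    Q (F * G) x = Q F x * G x + parity (F x) * Q G x := by
  rw [Q, Q, Q, Finset.sum_mul, Finset.mul_sum, ← Finset.sum_add_distrib]
  refine Finset.sum_congr rfl fun j _ => ?_
  have hc := mul_comm_of_even (parity_coeff_dPsi j (1 - Real.exp (-2 * x.1 j) - x.2 j ^ 2))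
    (parity (F x))
  have hb := psiBar_mul_eq j (F x)
  have hp := psi_mul_eq j (F x)
  rw [pderiv_mul hF hG, pderiv_mul hF hG, Pi.mul_apply, dPsi_mul, dPsiBar_mul]
  exact leibniz_site _ hb hp hc

theorem Q_mul_of_even {F G : Superfunction Λ} (hF : IsSmooth F) (hG : IsSmooth G)
    (he : IsEven F) : Q (F * G) = Q F * G + F * Q G :=
  funext fun x => by rw [Q_mul_apply hF hG, he]; rfl

theorem Q_mul_of_odd {F G : Superfunction Λ} (hF : IsSmooth F) (hG : IsSmooth G)
    (ho : IsOdd F) : Q (F * G) = Q F * G - F * Q G :=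
  funext fun x => by rw [Q_mul_apply hF hG, ho, neg_mul, ← sub_eq_add_neg]; rfl

theorem Q_const (a : Grassmann Λ) (x : Config Λ) :
    Q (fun _ : Config Λ => a) x = ∑ j, (-(x.2 j • dPsiBar j a)
      + (1 / 2 : ℝ) • ((algebraMap ℝ (Grassmann Λ) (1 - Real.exp (-2 * x.1 j) - x.2 j ^ 2)
        - (4 : ℝ) • (psiBar j * psi j)) * dPsi j a)) := by
  simp only [Q, pderiv_const, mul_zero, add_zero, zero_sub]

theorem Q_algebraMap_const (r : ℝ) :
    Q (fun _ : Config Λ => algebraMap ℝ (Grassmann Λ) r) = 0 := by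
  funext x
  rw [Q_const]
  refine Finset.sum_eq_zero fun j _ => ?_
  rw [dPsiBar_algebraMap, dPsi_algebraMap, smul_zero, mul_zero, smul_zero, neg_zero, add_zero]

theorem Q_one : Q (1 : Superfunction Λ) = 0 := by
  have h := Q_algebraMap_const (Λ := Λ) 1
  rwa [map_one] at h

theorem Q_smul_const (r : ℝ) {F : Superfunction Λ} (hF : IsSmooth F) : Q (r • F) = r • Q F := by
  have h : ∀ G : Superfunction Λ, r • G = (fun _ => algebraMap ℝ (Grassmann Λ) r) * G :=
    fun G => funext fun x => Algebra.smul_def r (G x)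
  rw [h, Q_mul_of_even (isSmooth_const _) hF (isEven_algebraMap _), Q_algebraMap_const, zero_mul,
    zero_add, h]

theorem Q_sub {F G : Superfunction Λ} (hF : IsSmooth F) (hG : IsSmooth G) :
    Q (F - G) = Q F - Q G := by
  have h : F - G = F + (-1 : ℝ) • G := by rw [neg_one_smul, sub_eq_add_neg]
  have hG' : IsSmooth ((-1 : ℝ) • G) := by rw [neg_one_smul]; exact hG.neg
  rw [h, Q_add hF hG', Q_smul_const _ hG, neg_one_smul, sub_eq_add_neg]

theorem Q_psiBar (i : Λ) (x : Config Λ) :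
    Q (fun _ : Config Λ => psiBar i) x = -algebraMap ℝ (Grassmann Λ) (x.2 i) := by
  rw [Q_const, Finset.sum_eq_single i]
  · rw [dPsiBar_psiBar, dPsi_psiBar, if_pos rfl, mul_zero, smul_zero, add_zero,
      Algebra.algebraMap_eq_smul_one]
  · intro j _ hj
    rw [dPsiBar_psiBar, dPsi_psiBar, if_neg hj, mul_zero, smul_zero, smul_zero, neg_zero, add_zero]
  · exact fun h => absurd (Finset.mem_univ i) h

theorem Q_psi (i : Λ) (x : Config Λ) :
    Q (fun _ : Config Λ => psi i) x
      = (1 / 2 : ℝ) • (algebraMap ℝ (Grassmann Λ) (1 - Real.exp (-2 * x.1 i) - x.2 i ^ 2)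
        - (4 : ℝ) • (psiBar i * psi i)) := by
  rw [Q_const, Finset.sum_eq_single i]
  · rw [dPsiBar_psi, dPsi_psi, if_pos rfl, mul_one, smul_zero, neg_zero, zero_add]
  · intro j _ hj
    rw [dPsiBar_psi, dPsi_psi, if_neg hj, mul_zero, smul_zero, smul_zero, neg_zero, add_zero]
  · exact fun h => absurd (Finset.mem_univ i) h

theorem Q_algebraMap {f : Config Λ → ℝ} {x : Config Λ} {ft fs : Λ → ℝ}
    (ht : ∀ j, HasLineDerivAt ℝ f (ft j) x (Pi.single j 1, 0))
    (hs : ∀ j, HasLineDerivAt ℝ f (fs j) x (0, Pi.single j 1)) :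
    Q (fun y => algebraMap ℝ (Grassmann Λ) (f y)) x
      = ∑ j, (ft j • psiBar j + fs j • (psi j - x.2 j • psiBar j)) := by
  rw [Q]
  refine Finset.sum_congr rfl fun j _ => ?_
  rw [pderiv_algebraMap (ht j), pderiv_algebraMap (hs j), dPsiBar_algebraMap,
    dPsi_algebraMap, smul_zero, mul_zero, smul_zero,
    sub_zero, add_zero, Algebra.algebraMap_eq_smul_one, Algebra.algebraMap_eq_smul_one,
    mul_smul_comm, mul_smul_comm, mul_one, mul_one]

/-- The chain rule for `Q`. -/
theorem Q_algebraMap_comp {b : Config Λ → ℝ} (hb : ContDiff ℝ ∞ b) {g : ℝ → ℝ} {x : Config Λ}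
    (hg : DifferentiableAt ℝ g (b x)) :
    Q (fun y => algebraMap ℝ (Grassmann Λ) (g (b y))) x
      = deriv g (b x) • Q (fun y => algebraMap ℝ (Grassmann Λ) (b y)) x := by
  have h1 : ∀ v, HasLineDerivAt ℝ b (lineDeriv ℝ b x v) x v := fun v =>
    ((hb.differentiable (by simp)) x).lineDifferentiableAt.hasLineDerivAt
  have h2 : ∀ v, HasLineDerivAt ℝ (fun y => g (b y)) (deriv g (b x) * lineDeriv ℝ b x v) x v :=
    fun v => by
      have h0 : b (x + (0 : ℝ) • v) = b x := by rw [zero_smul, add_zero]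
      have := HasDerivAt.comp (h₂ := g) (h := fun t : ℝ => b (x + t • v)) (0 : ℝ)
        (h₂' := deriv g (b x)) (by rw [h0]; exact hg.hasDerivAt) (h1 v)
      exact this
  rw [Q_algebraMap (fun j => h2 _) (fun j => h2 _), Q_algebraMap (fun j => h1 _) (fun j => h1 _),
    Finset.smul_sum]
  exact Finset.sum_congr rfl fun j _ => by rw [smul_add, smul_smul, smul_smul]

end Supersymmetry

/-! ### Functions of an invariant superfunction -/

section FunctionalCalculus

variable {Λ : Type*}

/-- The function `g` of the even superfunction `b + n`, where the nilpotent part `n` has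
square zero: the Taylor series of `g` at `b` stops at `g(b) + g'(b) n`. -/
def taylor (g : ℝ → ℝ) (b : Config Λ → ℝ) (n : Config Λ → evenPart Λ) (x : Config Λ) :
    evenPart Λ :=
  algebraMap ℝ (evenPart Λ) (g (b x)) + deriv g (b x) • n x

theorem coe_taylor (g : ℝ → ℝ) (b : Config Λ → ℝ) (n : Config Λ → evenPart Λ) (x : Config Λ) :
    (taylor g b n x : Grassmann Λ)
      = algebraMap ℝ (Grassmann Λ) (g (b x)) + deriv g (b x) • (n x : Grassmann Λ) := rfl

theorem taylor_mul {g h : ℝ → ℝ} (hg : Differentiable ℝ g) (hh : Differentiable ℝ h)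
    (b : Config Λ → ℝ) {n : Config Λ → evenPart Λ} (hsq : ∀ x, n x * n x = 0) (x : Config Λ) :
    taylor g b n x * taylor h b n x = taylor (fun u => g u * h u) b n x := by
  rw [taylor, taylor, taylor, deriv_fun_mul (hg _) (hh _)]
  simp only [Algebra.algebraMap_eq_smul_one, add_mul, mul_add, smul_mul_smul_comm, hsq, one_mul,
    mul_one, smul_zero, add_zero]
  module

variable [Fintype Λ] [DecidableEq Λ]

/-- A smooth even superfunction annihilated by `Q`. -/
structure IsInvariant (F : Superfunction Λ) : Prop where
  smooth : IsSmooth F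
  even : IsEven F
  Q_eq_zero : Q F = 0

theorem isInvariant_one : IsInvariant (1 : Superfunction Λ) :=
  ⟨isSmooth_const 1, fun _ => map_one _, Q_one⟩

theorem IsInvariant.mul {F G : Superfunction Λ} (hF : IsInvariant F) (hG : IsInvariant G) :
    IsInvariant (F * G) :=
  ⟨hF.smooth.mul hG.smooth, hF.even.mul hG.even, by
    rw [Q_mul_of_even hF.smooth hG.smooth hF.even, hF.Q_eq_zero, hG.Q_eq_zero, zero_mul, mul_zero,
      add_zero]⟩

theorem IsInvariant.prod {ι : Type*} {A : Finset ι} {H : ι → Config Λ → evenPart Λ}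
    (hH : ∀ i ∈ A, IsInvariant fun x => (H i x : Grassmann Λ)) :
    IsInvariant fun x => ((∏ i ∈ A, H i x : evenPart Λ) : Grassmann Λ) := by
  classical
  induction A using Finset.induction_on with
  | empty =>
    simp_rw [Finset.prod_empty]
    exact isInvariant_one
  | insert i A hi ih =>
    simp_rw [Finset.prod_insert hi]
    exact (hH i (Finset.mem_insert_self i A)).mul
      (ih fun j hj => hH j (Finset.mem_insert_of_mem hj))

/-- Functions of an invariant superfunction are invariant. -/
theorem isInvariant_taylor {g : ℝ → ℝ} (hg : ContDiff ℝ ∞ g) {b : Config Λ → ℝ}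
    (hb : ContDiff ℝ ∞ b) {n : Config Λ → evenPart Λ} (hn : IsSmooth fun x => (n x : Grassmann Λ))
    (hsq : ∀ x, n x * n x = 0)
    (hQ : Q (fun x => algebraMap ℝ (Grassmann Λ) (b x) + n x) = 0) :
    IsInvariant fun x => (taylor g b n x : Grassmann Λ) := by
  have hg' : ContDiff ℝ ∞ (deriv g) := (contDiff_infty_iff_deriv.1 hg).2
  set N : Superfunction Λ := fun x => (n x : Grassmann Λ) with hN
  have hNe : IsEven N := fun x => parity_coe_even (n x)
  have hbs := isSmooth_algebraMap hb
  have hgb := isSmooth_algebraMap (hg.comp hb)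
  have hgb' := isSmooth_algebraMap (hg'.comp hb)
  have hform : (fun x => (taylor g b n x : Grassmann Λ))
      = (fun x => algebraMap ℝ (Grassmann Λ) ((g ∘ b) x))
        + (fun x => algebraMap ℝ (Grassmann Λ) ((deriv g ∘ b) x)) * N := by
    funext x
    rw [coe_taylor, Algebra.smul_def]
    rfl
  refine ⟨hform ▸ hgb.add (hgb'.mul hn), fun x => parity_coe_even _, ?_⟩
  have hQ' : Q (fun x => algebraMap ℝ (Grassmann Λ) (b x)) + Q N = 0 := by
    rw [← Q_add hbs hn]
    exact hQ
  -- Applying `Q` to `n² = 0` shows `(Qn) n = 0`, which kills the second derivative of `g`.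
  have hnn : Q N * N = 0 := by
    have h0 : N * N = (fun _ => algebraMap ℝ (Grassmann Λ) 0) := by
      funext x
      rw [map_zero]
      exact congrArg Subtype.val (hsq x)
    have h1 := Q_mul_of_even hn hn hNe
    rw [h0, Q_algebraMap_const, hNe.mul_comm, ← two_smul ℝ] at h1
    exact (smul_eq_zero.1 h1.symm).resolve_left two_ne_zero
  have hbn : Q (fun x => algebraMap ℝ (Grassmann Λ) (b x)) * N = 0 := by
    rw [eq_neg_of_add_eq_zero_left hQ', neg_mul, hnn, neg_zero]
  rw [hform, Q_add hgb (hgb'.mul hn), Q_mul_of_even hgb' hn (isEven_algebraMap _)]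
  funext x
  have e1 := Q_algebraMap_comp hb (x := x) (hg.differentiable (by simp) (b x))
  have e2 := Q_algebraMap_comp hb (x := x) (hg'.differentiable (by simp) (b x))
  have e3 : Q (fun x => algebraMap ℝ (Grassmann Λ) (b x)) x * N x = 0 := congrFun hbn x
  have e4 : Q (fun x => algebraMap ℝ (Grassmann Λ) (b x)) x + Q N x = 0 := congrFun hQ' x
  simp only [Pi.add_apply, Pi.mul_apply, Function.comp_apply, Pi.zero_apply]
  rw [e1, e2, smul_mul_assoc, e3, smul_zero, zero_add, ← Algebra.smul_def, ← smul_add, e4,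
    smul_zero]

end FunctionalCalculus

/-! ### The embedding coordinates -/

section Coordinates

variable {Λ : Type*}

theorem hasDerivAt_fst_line (x v : Config Λ) (i : Λ) (r : ℝ) :
    HasDerivAt (fun τ : ℝ => (x + τ • v).1 i) (v.1 i) r := by
  simpa using ((hasDerivAt_id r).mul_const (v.1 i)).const_add (x.1 i)

theorem hasDerivAt_snd_line (x v : Config Λ) (i : Λ) (r : ℝ) :
    HasDerivAt (fun τ : ℝ => (x + τ • v).2 i) (v.2 i) r := by
  simpa using ((hasDerivAt_id r).mul_const (v.2 i)).const_add (x.2 i)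

/-- The light-cone coordinate `z + x = e^t`. -/
def plus (i : Λ) : Superfunction Λ := fun x => algebraMap ℝ (Grassmann Λ) (Real.exp (x.1 i))

/-- The coordinate `y = s e^t`. -/
def ycoord (i : Λ) : Superfunction Λ := fun x =>
  algebraMap ℝ (Grassmann Λ) (x.2 i * Real.exp (x.1 i))

theorem isEven_plus (i : Λ) : IsEven (plus i) := isEven_algebraMap _

theorem isEven_ycoord (i : Λ) : IsEven (ycoord i) := isEven_algebraMap _

theorem isSmooth_plus [Fintype Λ] (i : Λ) : IsSmooth (plus i) := isSmooth_algebraMap (by fun_prop)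

theorem isSmooth_ycoord [Fintype Λ] (i : Λ) : IsSmooth (ycoord i) :=
  isSmooth_algebraMap (by fun_prop)

variable [DecidableEq Λ]

/-- The light-cone coordinate `z - x = e^{-t} + (s² + 2 ψ̄ ψ) e^t`. -/
def minus (i : Λ) : Superfunction Λ := fun x =>
  algebraMap ℝ (Grassmann Λ) (Real.exp (-x.1 i) + x.2 i ^ 2 * Real.exp (x.1 i))
    + (2 * Real.exp (x.1 i)) • (psiBar i * psi i)

/-- The odd coordinate `ξ = e^t ψ̄`. -/
def xi (i : Λ) : Superfunction Λ := fun x => Real.exp (x.1 i) • psiBar i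

/-- The odd coordinate `η = e^t ψ`. -/
def eta (i : Λ) : Superfunction Λ := fun x => Real.exp (x.1 i) • psi i

/-- The coordinate `x = sinh t - (½ s² + ψ̄ ψ) e^t`. -/
def xcoord (i : Λ) : Superfunction Λ := (1 / 2 : ℝ) • (plus i - minus i)

theorem z_eq (i : Λ) : z i = (1 / 2 : ℝ) • (plus i + minus i) := by
  funext x
  simp only [z, plus, minus, Pi.smul_apply, Pi.add_apply, Real.cosh_eq,
    Algebra.algebraMap_eq_smul_one]
  module

/-- `S_ij` is minus the invariant bilinear form of two points of the superhyperboloid, with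
`z z' - x x'` written in light-cone coordinates. -/
theorem S_eq (i j : Λ) : S i j = (1 / 2 : ℝ) • (plus i * minus j + minus i * plus j)
    - ycoord i * ycoord j - xi i * eta j + eta i * xi j := by
  funext x
  have h1 : psiBar j * psi i = -(psi i * psiBar j) := ι_mul_ι_comm _ _
  have e1 : Real.exp (x.1 i - x.1 j) = Real.exp (x.1 i) * Real.exp (-x.1 j) := by
    rw [← Real.exp_add, sub_eq_add_neg]
  have e2 : Real.exp (-(x.1 i - x.1 j)) = Real.exp (-x.1 i) * Real.exp (x.1 j) := by
    rw [← Real.exp_add, neg_sub, sub_eq_neg_add]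
  simp only [S, plus, minus, xi, eta, ycoord, Pi.smul_apply, Pi.add_apply, Pi.sub_apply,
    Pi.mul_apply, Real.cosh_eq, e1, e2, Real.exp_add, Algebra.algebraMap_eq_smul_one, mul_add,
    add_mul, sub_mul, mul_sub, smul_mul_smul_comm, one_mul, mul_one, h1]
  module

/-- The constraint `z² - x² = 1 + y² + 2 ξ η` of the superhyperboloid. -/
theorem plus_mul_minus (i : Λ) : plus i * minus i
    = 1 + ycoord i * ycoord i + (2 : ℝ) • (xi i * eta i) := by
  funext x
  have e1 : Real.exp (x.1 i) * Real.exp (-x.1 i) = 1 := by rw [← Real.exp_add]; simp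
  simp only [plus, minus, xi, eta, ycoord, Pi.smul_apply, Pi.add_apply, Pi.one_apply,
    Pi.mul_apply, Algebra.algebraMap_eq_smul_one, mul_add, smul_mul_smul_comm, one_mul, e1]
  module

theorem xi_mul_eta (i : Λ) : xi i * eta i = -(eta i * xi i) := by
  funext x
  have h1 : psiBar i * psi i = -(psi i * psiBar i) := ι_mul_ι_comm _ _
  simp only [xi, eta, Pi.mul_apply, Pi.neg_apply, smul_mul_smul_comm, h1, smul_neg]

theorem isEven_minus (i : Λ) : IsEven (minus i) := fun x => by
  rw [minus, map_add, map_smul, AlgHom.commutes, map_mul, parity_psiBar, parity_psi, neg_mul_neg]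

theorem isEven_xcoord (i : Λ) : IsEven (xcoord i) := fun x => by
  rw [xcoord, Pi.smul_apply, map_smul, (isEven_plus i).sub (isEven_minus i) x]

theorem isOdd_xi (i : Λ) : IsOdd (xi i) := fun x => by
  rw [xi, map_smul, parity_psiBar, smul_neg]

theorem isOdd_eta (i : Λ) : IsOdd (eta i) := fun x => by
  rw [eta, map_smul, parity_psi, smul_neg]

/-- The odd superfunction `λ = x η - y ξ`, for which `Qλ = z² - 1`. -/
def lam (i : Λ) : Superfunction Λ := xcoord i * eta i - ycoord i * xi i

theorem isOdd_lam (i : Λ) : IsOdd (lam i) :=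
  ((isEven_xcoord i).mul_odd (isOdd_eta i)).sub ((isEven_ycoord i).mul_odd (isOdd_xi i))

variable [Fintype Λ]

theorem isSmooth_minus (i : Λ) : IsSmooth (minus i) :=
  (isSmooth_algebraMap (by fun_prop)).add ((isSmooth_const _).smul (by fun_prop))

theorem isSmooth_xi (i : Λ) : IsSmooth (xi i) := (isSmooth_const _).smul (by fun_prop)

theorem isSmooth_eta (i : Λ) : IsSmooth (eta i) := (isSmooth_const _).smul (by fun_prop)

theorem isSmooth_xcoord (i : Λ) : IsSmooth (xcoord i) :=
  ((isSmooth_plus i).sub (isSmooth_minus i)).const_smul _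

/-- `Q` of a function whose differential is `ft dt_i + fs ds_i`. -/
theorem Q_scalar_of_eq {f : Config Λ → ℝ} {x : Config Λ} {i : Λ} {ft fs : ℝ}
    (ht : ∀ v : Config Λ, HasLineDerivAt ℝ f (v.1 i * ft + v.2 i * fs) x v) :
    Q (fun y => algebraMap ℝ (Grassmann Λ) (f y)) x
      = ft • psiBar i + fs • (psi i - x.2 i • psiBar i) := by
  rw [Q_algebraMap (fun j => ht _) (fun j => ht _), Finset.sum_eq_single i]
  · simp
  · intro j _ hj
    simp [Ne.symm hj]
  · exact fun h => absurd (Finset.mem_univ i) h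

theorem Q_plus (i : Λ) : Q (plus i) = xi i := by
  funext x
  have h : ∀ v : Config Λ, HasLineDerivAt ℝ (fun y : Config Λ => Real.exp (y.1 i))
      (v.1 i * Real.exp (x.1 i) + v.2 i * 0) x v := fun v => by
    have := (hasDerivAt_fst_line x v i 0).exp
    simpa [HasLineDerivAt, mul_comm] using this
  exact (Q_scalar_of_eq h).trans (by rw [zero_smul, add_zero, xi])

theorem Q_ycoord (i : Λ) : Q (ycoord i) = eta i := by
  funext x
  have h : ∀ v : Config Λ, HasLineDerivAt ℝ (fun y : Config Λ => y.2 i * Real.exp (y.1 i))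
      (v.1 i * (x.2 i * Real.exp (x.1 i)) + v.2 i * Real.exp (x.1 i)) x v := fun v => by
    have := (hasDerivAt_snd_line x v i 0).fun_mul (hasDerivAt_fst_line x v i 0).exp
    have e : v.1 i * (x.2 i * Real.exp (x.1 i)) + v.2 i * Real.exp (x.1 i)
        = v.2 i * Real.exp (x.1 i) + x.2 i * (Real.exp (x.1 i) * v.1 i) := by ring
    rw [e]
    simpa [HasLineDerivAt] using this
  refine (Q_scalar_of_eq h).trans ?_
  rw [eta]
  module

theorem Q_xi (i : Λ) : Q (xi i) = -ycoord i := by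
  have h : xi i = plus i * fun _ => psiBar i := funext fun x => Algebra.smul_def _ _
  rw [h, Q_mul_of_even (isSmooth_plus i) (isSmooth_const _) (isEven_plus i), Q_plus]
  funext x
  simp only [Pi.add_apply, Pi.mul_apply, Pi.neg_apply, Q_psiBar, xi, plus, ycoord,
    smul_mul_assoc, psiBar_mul_self, smul_zero, zero_add, mul_neg, ← map_mul, mul_comm]

theorem Q_eta (i : Λ) : Q (eta i) = xcoord i := by
  have h : eta i = plus i * fun _ => psi i := funext fun x => Algebra.smul_def _ _
  rw [h, Q_mul_of_even (isSmooth_plus i) (isSmooth_const _) (isEven_plus i), Q_plus]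
  funext x
  have e : Real.exp (x.1 i) * Real.exp (-2 * x.1 i) = Real.exp (-x.1 i) := by
    rw [← Real.exp_add]
    ring_nf
  simp only [Pi.add_apply, Pi.mul_apply, Q_psi, xi, plus, xcoord, minus, Pi.smul_apply,
    Pi.sub_apply, Algebra.algebraMap_eq_smul_one, smul_mul_assoc, one_mul, ← e]
  module

theorem Q_minus (i : Λ) : Q (minus i) = -xi i := by
  -- `p m = 1 + y² + 2 ξ η` with `p = e^t` invertible determines `Q m`.
  have h := congrArg Q (plus_mul_minus i)
  have hyy := (isSmooth_ycoord i).mul (isSmooth_ycoord i)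
  have hxe := (isSmooth_xi i).mul (isSmooth_eta i)
  have hone : IsSmooth (1 : Superfunction Λ) := isSmooth_const 1
  rw [Q_mul_of_even (isSmooth_plus i) (isSmooth_minus i) (isEven_plus i),
    Q_add (hone.add hyy) (hxe.const_smul 2), Q_add hone hyy, Q_one, zero_add,
    Q_mul_of_even (isSmooth_ycoord i) (isSmooth_ycoord i) (isEven_ycoord i),
    Q_smul_const _ hxe, Q_mul_of_odd (isSmooth_xi i) (isSmooth_eta i) (isOdd_xi i), Q_plus,
    Q_ycoord, Q_xi, Q_eta, (isEven_ycoord i).mul_comm, xcoord] at h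
  have h' : plus i * Q (minus i) = plus i * -xi i := by
    have e1 : plus i * xi i = xi i * plus i := (isEven_plus i).mul_comm _
    have e2 : ycoord i * eta i = eta i * ycoord i := (isEven_ycoord i).mul_comm _
    rw [eq_sub_of_add_eq' h, mul_neg, e1, neg_mul, e2]
    simp only [mul_smul_comm, mul_sub]
    module
  funext x
  have hx := congrFun h' x
  simp only [Pi.mul_apply, plus, ← Algebra.smul_def] at hx
  exact smul_right_injective _ (Real.exp_ne_zero _) hx

theorem Q_z (i : Λ) : Q (z i) = 0 := by
  rw [z_eq, Q_smul_const _ ((isSmooth_plus i).add (isSmooth_minus i)),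
    Q_add (isSmooth_plus i) (isSmooth_minus i), Q_plus, Q_minus, add_neg_cancel, smul_zero]

theorem Q_xcoord (i : Λ) : Q (xcoord i) = xi i := by
  rw [xcoord, Q_smul_const _ ((isSmooth_plus i).sub (isSmooth_minus i)),
    Q_sub (isSmooth_plus i) (isSmooth_minus i), Q_plus, Q_minus]
  module

theorem Q_S (i j : Λ) : Q (S i j) = 0 := by
  have h1 := (isSmooth_plus i).mul (isSmooth_minus j)
  have h2 := (isSmooth_minus i).mul (isSmooth_plus j)
  have h12 : IsSmooth ((1 / 2 : ℝ) • (plus i * minus j + minus i * plus j)) :=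
    (h1.add h2).const_smul _
  have h3 := (isSmooth_ycoord i).mul (isSmooth_ycoord j)
  have h4 := (isSmooth_xi i).mul (isSmooth_eta j)
  have h5 := (isSmooth_eta i).mul (isSmooth_xi j)
  rw [S_eq, Q_add ((h12.sub h3).sub h4) h5, Q_sub (h12.sub h3) h4, Q_sub h12 h3,
    Q_smul_const _ (h1.add h2), Q_add h1 h2,
    Q_mul_of_even (isSmooth_plus i) (isSmooth_minus j) (isEven_plus i),
    Q_mul_of_even (isSmooth_minus i) (isSmooth_plus j) (isEven_minus i),
    Q_mul_of_even (isSmooth_ycoord i) (isSmooth_ycoord j) (isEven_ycoord i),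
    Q_mul_of_odd (isSmooth_xi i) (isSmooth_eta j) (isOdd_xi i),
    Q_mul_of_odd (isSmooth_eta i) (isSmooth_xi j) (isOdd_eta i)]
  simp only [Q_plus, Q_minus, Q_ycoord, Q_xi, Q_eta, xcoord, mul_sub, sub_mul, smul_mul_assoc,
    mul_smul_comm, mul_neg, neg_mul]
  module

theorem isSmooth_lam (i : Λ) : IsSmooth (lam i) :=
  ((isSmooth_xcoord i).mul (isSmooth_eta i)).sub ((isSmooth_ycoord i).mul (isSmooth_xi i))

theorem Q_lam (i : Λ) : Q (lam i) = z i * z i - 1 := by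
  have hpm := plus_mul_minus i
  have hmp : minus i * plus i = plus i * minus i := (isEven_minus i).mul_comm _
  rw [lam, Q_sub ((isSmooth_xcoord i).mul (isSmooth_eta i)) ((isSmooth_ycoord i).mul
      (isSmooth_xi i)), Q_mul_of_even (isSmooth_xcoord i) (isSmooth_eta i) (isEven_xcoord i),
    Q_mul_of_even (isSmooth_ycoord i) (isSmooth_xi i) (isEven_ycoord i), Q_xcoord, Q_eta,
    Q_ycoord, Q_xi, z_eq, xcoord]
  simp only [mul_sub, sub_mul, mul_add, add_mul, smul_mul_smul_comm, hmp, hpm, mul_neg,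
    xi_mul_eta]
  module

end Coordinates

/-! ### Invariance of the Berezin integral under `Q` -/

section Stokes

variable {Λ : Type*} [Fintype Λ]

instance : (volume : Measure (Config Λ)).IsAddHaarMeasure :=
  Measure.prod.instIsAddHaarMeasure (volume : Measure (Λ → ℝ)) (volume : Measure (Λ → ℝ))

theorem integral_fderiv_eq_zero {f : Config Λ → ℝ} (hf : ContDiff ℝ ∞ f)
    (hc : HasCompactSupport f) (v : Config Λ) :
    Integrable (fun x => fderiv ℝ f x v) ∧ ∫ x, fderiv ℝ f x v = 0 := by
  have hf' : Continuous fun x => fderiv ℝ f x v :=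
    (hf.continuous_fderiv (by simp)).clm_apply continuous_const
  have hi : Integrable (fun x => fderiv ℝ f x v) :=
    hf'.integrable_of_hasCompactSupport (hc.fderiv_apply ℝ v)
  refine ⟨hi, ?_⟩
  have h := integral_mul_fderiv_eq_neg_fderiv_mul_of_integrable (μ := (volume : Measure (Config Λ)))
    (f := fun _ => (1 : ℝ))
    (g := f) (v := v) (by simp) (by simpa using hi)
    (by simpa using hf.continuous.integrable_of_hasCompactSupport hc)
    (fun x _ => differentiableAt_const _) (fun x _ => hf.differentiable (by simp) x)
  simpa using h

theorem density_eq (x : Config Λ) :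
    density x = (∏ _j : Λ, (2 * Real.pi)⁻¹) * Real.exp (-∑ j, x.1 j) := by
  rw [density, Finset.prod_mul_distrib, ← Real.exp_sum, Finset.sum_neg_distrib]

theorem density_pos (x : Config Λ) : 0 < density x :=
  Finset.prod_pos fun _ _ => by positivity

theorem contDiff_density : ContDiff ℝ ∞ (density : Config Λ → ℝ) := by
  rw [funext (density_eq (Λ := Λ))]
  fun_prop

theorem hasLineDerivAt_density (x v : Config Λ) :
    HasLineDerivAt ℝ density (-(∑ j, v.1 j) * density x) x v := by
  have h1 : HasDerivAt (fun τ : ℝ => -∑ j, (x + τ • v).1 j) (-∑ j, v.1 j) 0 :=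
    (HasDerivAt.fun_sum fun j _ => hasDerivAt_fst_line x v j 0).neg
  have h2 := h1.exp.const_mul (∏ _j : Λ, (2 * Real.pi)⁻¹)
  have e : -(∑ j, v.1 j) * density x = (∏ _j : Λ, (2 * Real.pi)⁻¹)
      * (Real.exp (-∑ j, (x + (0 : ℝ) • v).1 j) * -∑ j, v.1 j) := by
    rw [density_eq, zero_smul, add_zero]
    ring
  rw [e, funext (density_eq (Λ := Λ))]
  exact h2

theorem _root_.HasCompactSupport.density_mul {G : Superfunction Λ} (hc : HasCompactSupport G)
    (l : Grassmann Λ →ₗ[ℝ] ℝ) : HasCompactSupport fun x => density x * l (G x) :=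
  hc.mono fun x hx h => hx (by simp only [h, map_zero, mul_zero])

theorem IsSmooth.contDiff_density_mul {G : Superfunction Λ} (hG : IsSmooth G)
    (l : Grassmann Λ →ₗ[ℝ] ℝ) : ContDiff ℝ ∞ fun x => density x * l (G x) :=
  contDiff_density.mul (hG.contDiff l)

theorem IsSmooth.integrable_density_mul {G : Superfunction Λ} (hG : IsSmooth G)
    (hc : HasCompactSupport G) (l : Grassmann Λ →ₗ[ℝ] ℝ) :
    Integrable fun x => density x * l (G x) :=
  (hG.contDiff_density_mul l).continuous.integrable_of_hasCompactSupport (hc.density_mul l)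

theorem IsSmooth.fderiv_density_mul {G : Superfunction Λ} (hG : IsSmooth G)
    (l : Grassmann Λ →ₗ[ℝ] ℝ) (x v : Config Λ) :
    fderiv ℝ (fun y => density y * l (G y)) x v
      = -(∑ j, v.1 j) * density x * l (G x) + density x * l (pderiv v G x) := by
  have h1 := ((hG.contDiff_density_mul l).differentiable (by simp) x).hasFDerivAt.hasLineDerivAt v
  have h2 := HasDerivAt.fun_mul (hasLineDerivAt_density x v) (hG.hasLineDerivAt l x v)
  simp only [zero_smul, add_zero] at h2
  exact HasDerivAt.unique h1 h2

variable [DecidableEq Λ]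

/-- The coefficient `ψ̄_j` of `∂_{t_j}` in `Q`. -/
def coeffT (j : Λ) : Superfunction Λ := fun _ => psiBar j

/-- The coefficient `ψ_j - s_j ψ̄_j` of `∂_{s_j}` in `Q`. -/
def coeffS (j : Λ) : Superfunction Λ := fun x => psi j - x.2 j • psiBar j

theorem isSmooth_coeffT (j : Λ) : IsSmooth (coeffT j) := isSmooth_const _

theorem isSmooth_coeffS (j : Λ) : IsSmooth (coeffS j) :=
  (isSmooth_const (psi j)).sub ((isSmooth_const (psiBar j)).smul (by fun_prop))

/-- The vector field `(ψ - s ψ̄) ∂_s` is not divergence free. -/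
theorem pderiv_coeffS (j : Λ) (x : Config Λ) :
    pderiv (0, Pi.single j 1) (coeffS j) x = -psiBar j := pderiv_eq_of_forall fun l => by
  have h := ((hasDerivAt_snd_line x (0, Pi.single j 1) j 0).mul_const (l (psiBar j))).const_sub
    (l (psi j))
  simpa [HasLineDerivAt, coeffS] using h

/-- The integrand of `∫ Dμ QG` is a divergence. The contributions of the derivative of the
density, of the divergence of `(ψ - s ψ̄) ∂_s` and of the term `-2 ψ̄ ψ ∂_ψ` cancel. -/
theorem density_mul_berezin_Q {G : Superfunction Λ} (hG : IsSmooth G) (x : Config Λ) :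
    density x * berezin (Q G x) = ∑ j,
      (fderiv ℝ (fun y => density y * berezin ((coeffT j * G) y)) x (Pi.single j 1, 0)
      + fderiv ℝ (fun y => density y * berezin ((coeffS j * G) y)) x
        (0, Pi.single j 1)) := by
  rw [Q, map_sum, Finset.mul_sum]
  refine Finset.sum_congr rfl fun j _ => ?_
  have hT : ∀ v, pderiv v (coeffT j) x = 0 := fun v => pderiv_const _ _ _
  rw [((isSmooth_coeffT j).mul hG).fderiv_density_mul,
    ((isSmooth_coeffS j).mul hG).fderiv_density_mul, pderiv_mul (isSmooth_coeffT j) hG,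
    pderiv_mul (isSmooth_coeffS j) hG, hT, pderiv_coeffS]
  simp only [coeffT, coeffS, Pi.mul_apply, map_add, map_sub, map_smul, smul_eq_mul, sub_mul,
    Pi.zero_apply,
    Finset.sum_const_zero, Finset.sum_pi_single', Finset.mem_univ, if_true, neg_zero, zero_mul,
    zero_add, neg_mul, map_neg, smul_mul_assoc, Algebra.algebraMap_eq_smul_one, one_mul,
    berezin_dPsi, berezin_dPsiBar, berezin_nu_mul_dPsi]
  ring

/-- The Berezin integral is invariant under `Q`. -/
theorem superIntegral_Q {G : Superfunction Λ} (hG : IsSmooth G) (hc : HasCompactSupport G) :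
    superIntegral (Q G) = 0 := by
  have h1 := fun j => integral_fderiv_eq_zero
    (((isSmooth_coeffT j).mul hG).contDiff_density_mul berezin)
    ((HasCompactSupport.mul_left (f := coeffT j) hc).density_mul berezin) (Pi.single j 1, 0)
  have h2 := fun j => integral_fderiv_eq_zero
    (((isSmooth_coeffS j).mul hG).contDiff_density_mul berezin)
    ((HasCompactSupport.mul_left (f := coeffS j) hc).density_mul berezin) (0, Pi.single j 1)
  simp_rw [superIntegral_eq, density_mul_berezin_Q hG]
  refine (integral_finsetSum _ fun j _ => (h1 j).1.add (h2 j).1).trans ?_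
  exact Finset.sum_eq_zero fun j _ => by
    rw [integral_add' (h1 j).1 (h2 j).1, (h1 j).2, (h2 j).2, add_zero]

end Stokes

/-! ### Localization by cutoffs -/

section Cutoff

variable {Λ : Type*}

/-- The body `cosh t + ½ s² e^t` of `z`. -/
def zBody (k : Λ) (x : Config Λ) : ℝ :=
  Real.cosh (x.1 k) + 1 / 2 * x.2 k ^ 2 * Real.exp (x.1 k)

theorem contDiff_zBody [Fintype Λ] (k : Λ) : ContDiff ℝ ∞ (zBody k) := by
  unfold zBody
  fun_prop

theorem cosh_le_zBody (k : Λ) (x : Config Λ) : Real.cosh (x.1 k) ≤ zBody k x := by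
  have : 0 ≤ 1 / 2 * x.2 k ^ 2 * Real.exp (x.1 k) := by positivity
  unfold zBody
  linarith

theorem one_le_zBody (k : Λ) (x : Config Λ) : 1 ≤ zBody k x :=
  (Real.one_le_cosh _).trans (cosh_le_zBody k x)

theorem exp_abs_le_zBody (k : Λ) (x : Config Λ) : Real.exp |x.1 k| ≤ 2 * zBody k x := by
  have h1 := cosh_le_zBody k x
  rw [← Real.cosh_abs, Real.cosh_eq] at h1
  linarith [Real.exp_pos (-|x.1 k|)]

theorem exp_le_zBody (k : Λ) (x : Config Λ) : Real.exp (x.1 k) ≤ 2 * zBody k x :=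
  (Real.exp_le_exp.2 (le_abs_self _)).trans (exp_abs_le_zBody k x)

theorem exp_neg_le_zBody (k : Λ) (x : Config Λ) : Real.exp (-x.1 k) ≤ 2 * zBody k x :=
  (Real.exp_le_exp.2 (neg_le_abs _)).trans (exp_abs_le_zBody k x)

theorem abs_fst_le_zBody (k : Λ) (x : Config Λ) : |x.1 k| ≤ 2 * zBody k x := by
  linarith [Real.add_one_le_exp |x.1 k|, exp_abs_le_zBody k x]

/-- On small neighbourhoods `z ≤ 1 + δ` of the zero field, `s²` is of order `δ`. -/
theorem snd_sq_le_zBody_mul (k : Λ) (x : Config Λ) :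
    x.2 k ^ 2 ≤ 4 * zBody k x * (zBody k x - 1) := by
  have h1 := one_le_zBody k x
  have h2 := exp_neg_le_zBody k x
  have h3 : x.2 k ^ 2 = 2 * (zBody k x - Real.cosh (x.1 k)) * Real.exp (-x.1 k) := by
    have : Real.exp (x.1 k) * Real.exp (-x.1 k) = 1 := by rw [← Real.exp_add]; simp
    rw [zBody]
    linear_combination -(x.2 k ^ 2) * this
  have h4 : zBody k x - Real.cosh (x.1 k) ≤ zBody k x - 1 := by
    linarith [Real.one_le_cosh (x.1 k)]
  rw [h3]
  nlinarith [Real.exp_pos (-x.1 k), cosh_le_zBody k x]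

theorem snd_sq_le_zBody (k : Λ) (x : Config Λ) : x.2 k ^ 2 ≤ (2 * zBody k x) ^ 2 := by
  nlinarith [snd_sq_le_zBody_mul k x, one_le_zBody k x]

/-- A superfunction which vanishes where one of the `z_k` is large has compact support. -/
theorem hasCompactSupport_of_zBody [Fintype Λ] {G : Superfunction Λ} {M : ℝ}
    (h : ∀ x k, M < zBody k x → G x = 0) : HasCompactSupport G := by
  refine HasCompactSupport.intro (isCompact_closedBall (0 : Config Λ) |2 * M|) fun x hx => ?_
  by_contra hG
  refine hx ?_
  have hle : ∀ k, zBody k x ≤ M := fun k => not_lt.1 fun hk => hG (h x k hk)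
  rw [mem_closedBall_zero_iff]
  refine norm_prod_le_iff.2 ⟨(pi_norm_le_iff_of_nonneg (abs_nonneg _)).2 fun k => ?_,
    (pi_norm_le_iff_of_nonneg (abs_nonneg _)).2 fun k => ?_⟩
  · rw [Real.norm_eq_abs]
    exact ((abs_fst_le_zBody k x).trans (by linarith [hle k])).trans (le_abs_self (2 * M))
  · rw [Real.norm_eq_abs]
    have h1 := abs_le_of_sq_le_sq (snd_sq_le_zBody k x) (by linarith [one_le_zBody k x])
    exact (h1.trans (by linarith [hle k])).trans (le_abs_self (2 * M))

/-- The cutoff function, equal to `1` on `u ≤ 1 + R` and to `0` on `u ≥ 1 + 2 R`. -/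
def chi (R u : ℝ) : ℝ := Real.smoothTransition (2 - (u - 1) / R)

theorem contDiff_chi (R : ℝ) : ContDiff ℝ ∞ (chi R) :=
  (Real.smoothTransition.contDiff (n := ⊤)).comp (by fun_prop)

theorem chi_eq_one {R u : ℝ} (hR : 0 < R) (hu : u ≤ 1 + R) : chi R u = 1 := by
  refine Real.smoothTransition.one_of_one_le ?_
  have : (u - 1) / R ≤ 1 := (div_le_one hR).2 (by linarith)
  linarith

theorem chi_eq_zero {R u : ℝ} (hR : 0 < R) (hu : 1 + 2 * R ≤ u) : chi R u = 0 := by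
  refine Real.smoothTransition.zero_of_nonpos ?_
  have : 2 ≤ (u - 1) / R := (le_div_iff₀ hR).2 (by linarith)
  linarith

theorem deriv_eq_zero_of_gt {g : ℝ → ℝ} {M u : ℝ} (hg : ∀ v, M < v → g v = 0) (hu : M < u) :
    deriv g u = 0 := by
  have h : g =ᶠ[nhds u] fun _ => 0 := by
    filter_upwards [lt_mem_nhds hu] with v hv using hg v hv
  rw [h.deriv_eq, deriv_const]

/-- The quotient `(χ_R - χ_r)(z) / (z² - 1)` of the difference of two cutoffs. -/
def chiQuot (R r u : ℝ) : ℝ := (chi R u - chi r u) / (u ^ 2 - 1)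

theorem chiQuot_eq_zero {R r u : ℝ} (hR : 0 < R) (hr : 0 < r) (hu : 1 + 2 * max R r < u) :
    chiQuot R r u = 0 := by
  rw [chiQuot, chi_eq_zero hR (by linarith [le_max_left R r]),
    chi_eq_zero hr (by linarith [le_max_right R r]), sub_zero, zero_div]

theorem chiQuot_mul {R r : ℝ} (hR : 0 < R) (hr : 0 < r) (u : ℝ) :
    (u ^ 2 - 1) * chiQuot R r u = chi R u - chi r u := by
  rcases eq_or_ne (u ^ 2 - 1) 0 with h | h
  · have hu : u ≤ 1 := by nlinarith
    rw [h, zero_mul, chi_eq_one hR (by linarith), chi_eq_one hr (by linarith), sub_self]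
  · rw [chiQuot, mul_div_cancel₀ _ h]

theorem contDiff_chiQuot {R r : ℝ} (hR : 0 < R) (hr : 0 < r) : ContDiff ℝ ∞ (chiQuot R r) := by
  refine contDiff_iff_contDiffAt.2 fun u => ?_
  rcases lt_or_ge u (1 + min R r) with hu | hu
  · have h : chiQuot R r =ᶠ[nhds u] fun _ => 0 := by
      filter_upwards [gt_mem_nhds hu] with v hv
      rw [chiQuot, chi_eq_one hR (by linarith [min_le_left R r]),
        chi_eq_one hr (by linarith [min_le_right R r]), sub_self, zero_div]
    exact contDiffAt_const.congr_of_eventuallyEq h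
  · have hu' : u ^ 2 - 1 ≠ 0 := by
      have := lt_min hR hr
      nlinarith
    exact ((contDiff_chi R).contDiffAt.sub (contDiff_chi r).contDiffAt).div
      (by fun_prop) hu'

variable [DecidableEq Λ]

/-- The nilpotent part `ψ̄ ψ e^t` of `z`. -/
def zNil (k : Λ) (x : Config Λ) : evenPart Λ := Real.exp (x.1 k) • nu k

theorem zNil_mul_self (k : Λ) (x : Config Λ) : zNil k x * zNil k x = 0 := by
  rw [zNil, smul_mul_smul_comm, nu, bilin_mul_self, smul_zero]

theorem z_apply (k : Λ) (x : Config Λ) :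
    z k x = algebraMap ℝ (Grassmann Λ) (zBody k x) + zNil k x := rfl

/-- The superfunction `g(z_k)`. -/
def zFun (g : ℝ → ℝ) (k : Λ) : Config Λ → evenPart Λ := taylor g (zBody k) (zNil k)

theorem zFun_eq_zero {g : ℝ → ℝ} {M : ℝ} (hg : ∀ v, M < v → g v = 0) {k : Λ} {x : Config Λ}
    (hx : M < zBody k x) : zFun g k x = 0 := by
  rw [zFun, taylor, hg _ hx, deriv_eq_zero_of_gt hg hx, map_zero, zero_smul, add_zero]

theorem coe_zFun_sq_sub_one (k : Λ) (x : Config Λ) :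
    (zFun (fun u => u ^ 2 - 1) k x : Grassmann Λ) = z k x * z k x - 1 := by
  have h : (zNil k x : Grassmann Λ) * zNil k x = 0 := congrArg Subtype.val (zNil_mul_self k x)
  have hd : deriv (fun u : ℝ => u ^ 2 - 1) (zBody k x) = 2 * zBody k x := by simp
  rw [zFun, coe_taylor, z_apply, hd]
  simp only [Algebra.algebraMap_eq_smul_one, mul_add, add_mul, smul_mul_assoc, mul_smul_comm, h,
    one_mul, mul_one]
  module

/-- The difference of two cutoffs is divisible by `z² - 1`. -/
theorem zFun_chi_sub {R r : ℝ} (hR : 0 < R) (hr : 0 < r) (k : Λ) (x : Config Λ) :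
    zFun (chi R) k x - zFun (chi r) k x
      = zFun (fun u => u ^ 2 - 1) k x * zFun (chiQuot R r) k x := by
  have h : (fun u => (u ^ 2 - 1) * chiQuot R r u) = fun u => chi R u - chi r u :=
    funext (chiQuot_mul hR hr)
  rw [zFun, zFun, zFun, zFun, taylor_mul (by fun_prop)
    ((contDiff_chiQuot hR hr).differentiable (by simp)) _ (zNil_mul_self k), h, taylor, taylor,
    taylor, deriv_fun_sub ((contDiff_chi R).differentiable (by simp) _)
    ((contDiff_chi r).differentiable (by simp) _), map_sub, sub_smul]
  abel

variable [Fintype Λ]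

theorem isInvariant_zFun {g : ℝ → ℝ} (hg : ContDiff ℝ ∞ g) (k : Λ) :
    IsInvariant fun x => (zFun g k x : Grassmann Λ) :=
  isInvariant_taylor hg (contDiff_zBody k) ((isSmooth_const _).smul (by fun_prop))
    (zNil_mul_self k) (Q_z k)

/-- The product of the cutoffs `χ_{R_k}(z_k)`. -/
def cutoff (R : Λ → ℝ) (x : Config Λ) : evenPart Λ := ∏ k, zFun (chi (R k)) k x

theorem isInvariant_cutoff (R : Λ → ℝ) : IsInvariant fun x => (cutoff R x : Grassmann Λ) :=
  IsInvariant.prod fun k _ => isInvariant_zFun (contDiff_chi (R k)) k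

theorem hasCompactSupport_cutoff_mul {R : Λ → ℝ} (hR : ∀ k, 0 < R k) (F : Superfunction Λ) :
    HasCompactSupport fun x => (cutoff R x : Grassmann Λ) * F x := by
  refine hasCompactSupport_of_zBody (M := ∑ k, (1 + 2 * R k)) fun x k hk => ?_
  have hle : 1 + 2 * R k ≤ ∑ k, (1 + 2 * R k) :=
    Finset.single_le_sum (f := fun k => 1 + 2 * R k) (fun i _ => by linarith [hR i])
      (Finset.mem_univ k)
  rw [cutoff, Finset.prod_eq_zero (Finset.mem_univ k) (zFun_eq_zero
    (fun v hv => chi_eq_zero (hR k) hv.le) (hle.trans_lt hk)), ZeroMemClass.coe_zero, zero_mul]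

theorem IsSmooth.cutoff_mul {F : Superfunction Λ} (hF : IsSmooth F) (R : Λ → ℝ) :
    IsSmooth fun x => (cutoff R x : Grassmann Λ) * F x :=
  (isInvariant_cutoff R).smooth.mul hF

/-- Changing the size of the cutoff at one site changes the integrand by a `Q`-exact term. -/
theorem superIntegral_cutoff_update {F : Superfunction Λ} (hF : IsSmooth F) (hQ : Q F = 0)
    {R : Λ → ℝ} (hR : ∀ k, 0 < R k) (i : Λ) {r : ℝ} (hr : 0 < r) :
    superIntegral (fun x => (cutoff R x : Grassmann Λ) * F x)
      = superIntegral (fun x => (cutoff (Function.update R i r) x : Grassmann Λ) * F x) := by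
  have hR' : ∀ k, 0 < Function.update R i r k := fun k => by
    rcases eq_or_ne k i with rfl | h
    · rwa [Function.update_self]
    · rw [Function.update_of_ne h]
      exact hR k
  set P : Config Λ → evenPart Λ := fun x => ∏ k ∈ Finset.univ.erase i, zFun (chi (R k)) k x
  have hcR : ∀ x, cutoff R x = zFun (chi (R i)) i x * P x := fun x =>
    (Finset.mul_prod_erase _ _ (Finset.mem_univ i)).symm
  have hcr : ∀ x, cutoff (Function.update R i r) x = zFun (chi r) i x * P x := fun x => by
    rw [cutoff, ← Finset.mul_prod_erase _ _ (Finset.mem_univ i), Function.update_self]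
    congr 1
    exact Finset.prod_congr rfl fun k hk => by
      rw [Function.update_of_ne (Finset.ne_of_mem_erase hk)]
  have hPi : IsInvariant fun x => (P x : Grassmann Λ) :=
    IsInvariant.prod fun k _ => isInvariant_zFun (contDiff_chi (R k)) k
  have hK : IsInvariant (fun x => (zFun (chiQuot (R i) r) i x * P x : Grassmann Λ)) :=
    (isInvariant_zFun (contDiff_chiQuot (hR i) hr) i).mul hPi
  set K : Superfunction Λ := fun x => (zFun (chiQuot (R i) r) i x * P x : Grassmann Λ)
  have hKF : Q (K * F) = 0 := by
    rw [Q_mul_of_even hK.smooth hF hK.even, hK.Q_eq_zero, hQ, zero_mul, mul_zero, add_zero]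
  have hG : IsSmooth (lam i * (K * F)) := (isSmooth_lam i).mul (hK.smooth.mul hF)
  have hc : HasCompactSupport (lam i * (K * F)) := by
    refine hasCompactSupport_of_zBody
      (M := 1 + 2 * max (R i) r + ∑ k, (1 + 2 * R k)) fun x k hk => ?_
    have hpos : ∀ k, 0 ≤ 1 + 2 * R k := fun k => by linarith [hR k]
    suffices h : zFun (chiQuot (R i) r) i x * P x = 0 by
      have h' : K x = 0 := congrArg Subtype.val h
      rw [Pi.mul_apply, Pi.mul_apply, h', zero_mul, mul_zero]
    rcases eq_or_ne k i with rfl | hki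
    · rw [zFun_eq_zero (fun v hv => chiQuot_eq_zero (hR k) hr hv)
        (lt_of_le_of_lt (le_add_of_nonneg_right (Finset.sum_nonneg fun k _ => hpos k)) hk),
        zero_mul]
    · have hle : 1 + 2 * R k ≤ ∑ k, (1 + 2 * R k) :=
        Finset.single_le_sum (f := fun k => 1 + 2 * R k) (fun i _ => hpos i) (Finset.mem_univ k)
      have hmax : 0 < max (R i) r := lt_max_of_lt_left (hR i)
      have hz : zFun (chi (R k)) k x = 0 :=
        zFun_eq_zero (fun v hv => chi_eq_zero (hR k) hv.le) (by linarith)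
      have hPx : P x = 0 := Finset.prod_eq_zero (Finset.mem_erase.2 ⟨hki, Finset.mem_univ k⟩) hz
      rw [hPx, mul_zero]
  have hexact : Q (lam i * (K * F)) = (fun x => (cutoff R x : Grassmann Λ) * F x)
      - fun x => (cutoff (Function.update R i r) x : Grassmann Λ) * F x := by
    rw [Q_mul_of_odd (isSmooth_lam i) (hK.smooth.mul hF) (isOdd_lam i), hKF, mul_zero, sub_zero,
      Q_lam]
    funext x
    have h : (z i x * z i x - 1) * K x
        = ((zFun (chi (R i)) i x - zFun (chi r) i x) * P x : evenPart Λ) := by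
      rw [zFun_chi_sub (hR i) hr, mul_assoc, ← coe_zFun_sq_sub_one]
      rfl
    simp only [Pi.mul_apply, Pi.sub_apply, Pi.one_apply]
    rw [← mul_assoc, h, ← sub_mul, hcR, hcr, sub_mul]
    rfl
  have h0 := superIntegral_Q hG hc
  rw [hexact, superIntegral_eq] at h0
  simp only [Pi.sub_apply, map_sub, mul_sub] at h0
  rw [integral_sub ((hF.cutoff_mul R).integrable_density_mul
      (hasCompactSupport_cutoff_mul hR F) berezin)
    ((hF.cutoff_mul _).integrable_density_mul (hasCompactSupport_cutoff_mul hR' F) berezin)] at h0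
  exact sub_eq_zero.1 h0

/-- The Berezin integral of an invariant superfunction with cutoffs does not depend on the size
of the cutoffs. -/
theorem superIntegral_cutoff_const {F : Superfunction Λ} (hF : IsSmooth F) (hQ : Q F = 0)
    {R r : ℝ} (hR : 0 < R) (hr : 0 < r) :
    superIntegral (fun x => (cutoff (fun _ => R) x : Grassmann Λ) * F x)
      = superIntegral (fun x => (cutoff (fun _ => r) x : Grassmann Λ) * F x) := by
  have h : ∀ A : Finset Λ, superIntegral (fun x => (cutoff (fun _ => R) x : Grassmann Λ) * F x)
      = superIntegral (fun x => (cutoff (fun k => if k ∈ A then r else R) x : Grassmann Λ)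
        * F x) := fun A => by
    induction A using Finset.induction_on with
    | empty => simp
    | insert i A hi ih =>
      have hu : (fun k => if k ∈ insert i A then r else R)
          = Function.update (fun k => if k ∈ A then r else R) i r := by
        funext k
        rcases eq_or_ne k i with rfl | hk
        · simp
        · simp [hk]
      rw [ih, hu]
      exact superIntegral_cutoff_update hF hQ (fun k => by split_ifs <;> assumption) i hr
  simpa using h Finset.univ

end Cutoff

/-! ### Removing the cutoffs -/

section RemoveCutoff

theorem chi_eq_chi_one (R u : ℝ) : chi R u = chi 1 (1 + (u - 1) / R) := by
  simp [chi]

theorem deriv_chi (R u : ℝ) : deriv (chi R) u = deriv (chi 1) (1 + (u - 1) / R) / R := by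
  have h1 : HasDerivAt (fun v : ℝ => 1 + (v - 1) / R) (1 / R) u :=
    (((hasDerivAt_id u).sub_const 1).div_const R).const_add 1
  have h2 := ((contDiff_chi 1).differentiable (by simp) (1 + (u - 1) / R)).hasDerivAt.comp u h1
  have h3 : (chi 1 ∘ fun v : ℝ => 1 + (v - 1) / R) = chi R :=
    funext fun v => (chi_eq_chi_one R v).symm
  rw [h3] at h2
  rw [h2.deriv]
  ring

theorem continuous_deriv_chi (R : ℝ) : Continuous (deriv (chi R)) :=
  (contDiff_chi R).continuous_deriv (by simp)

theorem deriv_chi_eq_zero_of_gt {R u : ℝ} (hR : 0 < R) (hu : 1 + 2 * R < u) :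
    deriv (chi R) u = 0 :=
  deriv_eq_zero_of_gt (fun _ hv => chi_eq_zero hR hv.le) hu

theorem deriv_chi_eq_zero_of_lt {R u : ℝ} (hR : 0 < R) (hu : u < 1 + R) :
    deriv (chi R) u = 0 := by
  have h : chi R =ᶠ[𝓝 u] fun _ => 1 := by
    filter_upwards [gt_mem_nhds hu] with v hv using chi_eq_one hR hv.le
  rw [h.deriv_eq, deriv_const]

theorem hasCompactSupport_deriv_chi {R : ℝ} (hR : 0 < R) : HasCompactSupport (deriv (chi R)) :=
  HasCompactSupport.intro (isCompact_Icc (a := 1 + R) (b := 1 + 2 * R)) fun u hu => by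
    rcases lt_or_ge u (1 + R) with h | h
    · exact deriv_chi_eq_zero_of_lt hR h
    · exact deriv_chi_eq_zero_of_gt hR (lt_of_not_ge fun h' => hu ⟨h, h'⟩)

theorem exists_bound_deriv_chi : ∃ B, 0 ≤ B ∧ ∀ u, |deriv (chi 1) u| ≤ B := by
  obtain ⟨B, hB⟩ := (hasCompactSupport_deriv_chi one_pos).exists_bound_of_continuous
    (continuous_deriv_chi 1)
  exact ⟨B, (norm_nonneg _).trans (hB 0), hB⟩

theorem abs_chi_le_one (R u : ℝ) : |chi R u| ≤ 1 := by
  rw [chi, abs_of_nonneg (Real.smoothTransition.nonneg _)]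
  exact Real.smoothTransition.le_one _

variable {Λ : Type*} [Fintype Λ]

theorem integrable_density_mul_of_isIntegrable {F : Superfunction Λ} (hF : IsIntegrable F)
    (l : Grassmann Λ →ₗ[ℝ] ℝ) : Integrable fun x => density x * l (F x) := by
  simp_rw [apply_eq_sum_coeff l F, Finset.mul_sum, ← mul_assoc]
  exact integrable_finsetSum _ fun I _ => (hF I).mul_const _

variable [DecidableEq Λ]

/-- The even element `∏_k (a_k + d_k ψ̄_k ψ_k)`. -/
def pairProd (a d : Λ → ℝ) : evenPart Λ :=
  ∏ k, (d k • nu k + algebraMap ℝ (evenPart Λ) (a k))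

theorem apply_pairProd_mul (l : Grassmann Λ →ₗ[ℝ] ℝ) (a d : Λ → ℝ) (f : Grassmann Λ) :
    l (pairProd a d * f) = ∑ A ∈ Finset.univ.powerset,
      (∏ k ∈ A, d k) * (∏ k ∈ Finset.univ \ A, a k) *
        l (((∏ k ∈ A, nu k : evenPart Λ) : Grassmann Λ) * f) := by
  rw [pairProd, Finset.prod_add, AddSubmonoidClass.coe_finsetSum, Finset.sum_mul, map_sum]
  refine Finset.sum_congr rfl fun A _ => ?_
  have h : (∏ k ∈ A, d k • nu k) * ∏ k ∈ Finset.univ \ A, algebraMap ℝ (evenPart Λ) (a k)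
      = ((∏ k ∈ A, d k) * ∏ k ∈ Finset.univ \ A, a k) • ∏ k ∈ A, nu k := by
    rw [Finset.prod_smul, ← map_prod, mul_comm, ← Algebra.smul_def, smul_smul, mul_comm]
  rw [h, coe_smul_mul, map_smul, smul_eq_mul]

/-- A bound on the linear forms of `∏_k (a_k + d_k ψ̄_k ψ_k) f` which is uniform in the
coefficients `|a_k| ≤ 1` and `|d_k| ≤ D`. -/
def pairBound (D : ℝ) (l : Grassmann Λ →ₗ[ℝ] ℝ) (f : Grassmann Λ) : ℝ :=
  ∑ A ∈ Finset.univ.powerset, D ^ A.card *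
    |l (((∏ k ∈ A, nu k : evenPart Λ) : Grassmann Λ) * f)|

theorem abs_apply_pairProd_mul_le {D : ℝ} {a d : Λ → ℝ} (ha : ∀ k, |a k| ≤ 1)
    (hd : ∀ k, |d k| ≤ D) (l : Grassmann Λ →ₗ[ℝ] ℝ) (f : Grassmann Λ) :
    |l (pairProd a d * f)| ≤ pairBound D l f := by
  rw [apply_pairProd_mul, pairBound]
  refine (Finset.abs_sum_le_sum_abs _ _).trans (Finset.sum_le_sum fun A _ => ?_)
  rw [abs_mul, abs_mul, Finset.abs_prod, Finset.abs_prod]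
  refine mul_le_mul_of_nonneg_right ?_ (abs_nonneg _)
  have h1 : ∏ k ∈ A, |d k| ≤ D ^ A.card := by
    rw [← Finset.prod_const]
    exact Finset.prod_le_prod (fun k _ => abs_nonneg _) fun k _ => hd k
  have h2 : ∏ k ∈ Finset.univ \ A, |a k| ≤ 1 :=
    Finset.prod_le_one (fun k _ => abs_nonneg _) fun k _ => ha k
  calc (∏ k ∈ A, |d k|) * ∏ k ∈ Finset.univ \ A, |a k|
      ≤ (∏ k ∈ A, |d k|) * 1 :=
        mul_le_mul_of_nonneg_left h2 (Finset.prod_nonneg fun k _ => abs_nonneg _)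
    _ ≤ D ^ A.card := by rwa [mul_one]

theorem cutoff_eq_pairProd (R : Λ → ℝ) (x : Config Λ) :
    cutoff R x = pairProd (fun k => chi (R k) (zBody k x))
      (fun k => deriv (chi (R k)) (zBody k x) * Real.exp (x.1 k)) :=
  Finset.prod_congr rfl fun k _ => by
    rw [zFun, taylor, zNil, smul_smul, add_comm]

/-- The cutoffs may be removed from the Berezin integral of an integrable superfunction. -/
theorem tendsto_superIntegral_cutoff_atTop {F : Superfunction Λ} (hF : IsSmooth F)
    (hi : IsIntegrable F) :
    Tendsto (fun R : ℝ => superIntegral (fun x => (cutoff (fun _ => R) x : Grassmann Λ) * F x))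
      atTop (𝓝 (superIntegral F)) := by
  obtain ⟨B, hB0, hB⟩ := exists_bound_deriv_chi
  refine tendsto_integral_filter_of_dominated_convergence
    (fun x => density x * pairBound (6 * B) berezin (F x)) ?_ ?_ ?_ ?_
  · exact Eventually.of_forall fun R =>
      ((hF.cutoff_mul _).contDiff_density_mul berezin).continuous.aestronglyMeasurable
  · filter_upwards [eventually_ge_atTop 1] with R hR
    refine Eventually.of_forall fun x => ?_
    have hR0 : 0 < R := by linarith
    change ‖density x * berezin _‖ ≤ _
    rw [norm_mul, Real.norm_eq_abs, Real.norm_eq_abs, abs_of_pos (density_pos x),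
      cutoff_eq_pairProd]
    refine mul_le_mul_of_nonneg_left (abs_apply_pairProd_mul_le (fun k => abs_chi_le_one _ _)
      (fun k => ?_) _ _) (density_pos x).le
    -- The derivative of the cutoff is of order `1 / R` and supported where `e^t` is of order `R`.
    rcases lt_or_ge (1 + 2 * R) (zBody k x) with h | h
    · rw [deriv_chi_eq_zero_of_gt hR0 h, zero_mul, abs_zero]
      positivity
    · rw [deriv_chi, abs_mul, abs_div, abs_of_pos hR0, abs_of_pos (Real.exp_pos _)]
      have h1 : Real.exp (x.1 k) ≤ 6 * R := (exp_le_zBody k x).trans (by linarith)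
      calc |deriv (chi 1) (1 + (zBody k x - 1) / R)| / R * Real.exp (x.1 k)
          ≤ B / R * (6 * R) := by
            refine mul_le_mul ?_ h1 (Real.exp_pos _).le (by positivity)
            exact div_le_div_of_nonneg_right (hB _) hR0.le
        _ = 6 * B := by field_simp
  · simp only [pairBound, Finset.mul_sum]
    refine integrable_finsetSum _ fun A _ => ?_
    have h := (integrable_density_mul_of_isIntegrable hi (berezin ∘ₗ
      LinearMap.mulLeft ℝ ((∏ k ∈ A, nu k : evenPart Λ) : Grassmann Λ))).abs.const_mul
      ((6 * B) ^ A.card)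
    refine h.congr (Eventually.of_forall fun x => ?_)
    simp only [LinearMap.comp_apply, LinearMap.mulLeft_apply, abs_mul, abs_of_pos (density_pos x)]
    ring
  · refine Eventually.of_forall fun x => tendsto_const_nhds.congr' ?_
    filter_upwards [eventually_gt_atTop (∑ k, zBody k x), eventually_gt_atTop 0] with R hR hR0
    have hk : ∀ k, zBody k x < 1 + R := fun k => by
      have := Finset.single_le_sum (f := fun k => zBody k x)
        (fun i _ => zero_le_one.trans (one_le_zBody i x)) (Finset.mem_univ k)
      linarith
    have h1 : cutoff (fun _ => R) x = 1 := Finset.prod_eq_one fun k _ => by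
      rw [zFun, taylor, chi_eq_one hR0 (hk k).le, deriv_chi_eq_zero_of_lt hR0 (hk k), zero_smul,
        add_zero, map_one]
    rw [h1, OneMemClass.coe_one, one_mul]

end RemoveCutoff

/-! ### The limit of small cutoffs -/

section Normalization

variable {Λ : Type*} [Fintype Λ]

/-- In polar coordinates the integrand is `2π` times the radial derivative of `χ(1 + r²/2)`, which
decreases from `1` to `0`. -/
theorem integral_deriv_chi_radial :
    ∫ p : ℝ × ℝ, deriv (chi 1) (1 + (p.1 ^ 2 + p.2 ^ 2) / 2) = -(2 * Real.pi) := by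
  have hderiv : ∀ r : ℝ, HasDerivAt (fun r : ℝ => chi 1 (1 + r ^ 2 / 2))
      (r * deriv (chi 1) (1 + r ^ 2 / 2)) r := fun r => by
    have h1 : HasDerivAt (fun r : ℝ => 1 + r ^ 2 / 2) r r := by
      have h := ((hasDerivAt_pow 2 r).div_const 2).const_add 1
      simpa using h
    have h2 := ((contDiff_chi 1).differentiable (by simp) (1 + r ^ 2 / 2)).hasDerivAt.comp r h1
    rw [mul_comm]
    exact h2
  have hcont : Continuous fun r : ℝ => r * deriv (chi 1) (1 + r ^ 2 / 2) :=
    continuous_id.mul ((continuous_deriv_chi 1).comp (by fun_prop))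
  have hsupp : HasCompactSupport fun r : ℝ => r * deriv (chi 1) (1 + r ^ 2 / 2) := by
    refine HasCompactSupport.intro (isCompact_Icc (a := (-2 : ℝ)) (b := 2)) fun r hr => ?_
    have h : 1 + 2 * (1 : ℝ) < 1 + r ^ 2 / 2 := by
      by_contra h
      exact hr (abs_le.1 (abs_le_of_sq_le_sq (by linarith) (by norm_num)))
    rw [deriv_chi_eq_zero_of_gt one_pos h, mul_zero]
  have hint : ∫ r in Set.Ioi (0 : ℝ), r * deriv (chi 1) (1 + r ^ 2 / 2) = -1 := by
    have hlim : Tendsto (fun r : ℝ => chi 1 (1 + r ^ 2 / 2)) atTop (𝓝 0) := by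
      refine tendsto_const_nhds.congr' ?_
      filter_upwards [eventually_ge_atTop 2] with r hr
      rw [chi_eq_zero one_pos (by nlinarith)]
    rw [integral_Ioi_of_hasDerivAt_of_tendsto' (fun r _ => hderiv r)
      (hcont.integrable_of_hasCompactSupport hsupp).integrableOn hlim,
      chi_eq_one one_pos (by norm_num)]
    norm_num
  rw [← integral_comp_polarCoord_symm]
  have h : ∀ p : ℝ × ℝ, p.1 • deriv (chi 1)
      (1 + ((polarCoord.symm p).1 ^ 2 + (polarCoord.symm p).2 ^ 2) / 2)
      = (p.1 * deriv (chi 1) (1 + p.1 ^ 2 / 2)) * (fun _ : ℝ => (1 : ℝ)) p.2 := fun p => by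
    have : (p.1 * Real.cos p.2) ^ 2 + (p.1 * Real.sin p.2) ^ 2 = p.1 ^ 2 := by
      linear_combination p.1 ^ 2 * Real.sin_sq_add_cos_sq p.2
    rw [polarCoord_symm_apply, this, smul_eq_mul, mul_one]
  simp_rw [h]
  rw [polarCoord_target, Measure.volume_eq_prod, setIntegral_prod_mul
    (fun r : ℝ => r * deriv (chi 1) (1 + r ^ 2 / 2)) (fun _ : ℝ => (1 : ℝ)), hint,
    setIntegral_const, Real.volume_real_Ioo_of_le (by linarith [Real.pi_pos]), smul_eq_mul]
  ring

/-- The normalization integral factorizes over the sites. -/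
theorem integral_prod_deriv_chi :
    ∫ y : Config Λ, (∏ _k : Λ, (2 * Real.pi)⁻¹) *
      ∏ k, deriv (chi 1) (1 + (y.1 k ^ 2 + y.2 k ^ 2) / 2) = (-1) ^ Fintype.card Λ := by
  have h := (volume_measurePreserving_arrowProdEquivProdArrow ℝ ℝ Λ).integral_comp'
    (fun y : Config Λ => (∏ _k : Λ, (2 * Real.pi)⁻¹) *
      ∏ k, deriv (chi 1) (1 + (y.1 k ^ 2 + y.2 k ^ 2) / 2))
  have h2 : ∀ w : Λ → ℝ × ℝ, (∏ _k : Λ, (2 * Real.pi)⁻¹) * ∏ k, deriv (chi 1)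
      (1 + ((MeasurableEquiv.arrowProdEquivProdArrow ℝ ℝ Λ w).1 k ^ 2
        + (MeasurableEquiv.arrowProdEquivProdArrow ℝ ℝ Λ w).2 k ^ 2) / 2)
      = (∏ _k : Λ, (2 * Real.pi)⁻¹) * ∏ k, (fun p : ℝ × ℝ =>
        deriv (chi 1) (1 + (p.1 ^ 2 + p.2 ^ 2) / 2)) (w k) := fun w => rfl
  simp_rw [h2] at h
  refine h.symm.trans ?_
  rw [integral_const_mul, integral_fintype_prod_volume_eq_pow (fun p : ℝ × ℝ =>
    deriv (chi 1) (1 + (p.1 ^ 2 + p.2 ^ 2) / 2)), integral_deriv_chi_radial, Finset.prod_const,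
    Finset.card_univ, ← mul_pow]
  congr 1
  have := Real.pi_pos.ne'
  field_simp

end Normalization

section Localization

theorem cosh_eq_one_add_sinh_sq (u : ℝ) : Real.cosh u = 1 + 2 * Real.sinh (u / 2) ^ 2 := by
  have h := Real.cosh_two_mul (u / 2)
  rw [Real.cosh_sq, mul_div_cancel₀ u two_ne_zero] at h
  rw [h]
  ring

theorem one_add_sq_div_two_le_cosh (u : ℝ) : 1 + u ^ 2 / 2 ≤ Real.cosh u := by
  have h : (u / 2) ^ 2 ≤ Real.sinh (u / 2) ^ 2 := by
    rw [sq_le_sq, Real.abs_sinh]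
    exact Real.self_le_sinh_iff.2 (abs_nonneg _)
  rw [cosh_eq_one_add_sinh_sq]
  linarith

variable {Λ : Type*}

/-- The argument of the rescaled cutoff `χ_{ε²}(z_k)` at the configuration `ε y`. -/
def scaledBody (ε : ℝ) (y : Config Λ) (k : Λ) : ℝ := 1 + (zBody k (ε • y) - 1) / ε ^ 2

theorem tendsto_scaledBody (y : Config Λ) (k : Λ) :
    Tendsto (fun ε : ℝ => scaledBody ε y k) (𝓝[>] 0)
      (𝓝 (1 + (y.1 k ^ 2 + y.2 k ^ 2) / 2)) := by
  have hs : Tendsto (fun ε : ℝ => Real.sinh (ε * (y.1 k / 2)) / ε) (𝓝[>] 0) (𝓝 (y.1 k / 2)) := by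
    have h1 : HasDerivAt (fun ε : ℝ => Real.sinh (ε * (y.1 k / 2))) (y.1 k / 2) 0 := by
      have h := ((hasDerivAt_id (0 : ℝ)).mul_const (y.1 k / 2)).sinh
      simpa using h
    have h2 := h1.tendsto_slope_zero_right
    refine h2.congr fun ε => ?_
    simp [div_eq_inv_mul]
  have he : Tendsto (fun ε : ℝ => Real.exp (ε * y.1 k)) (𝓝[>] 0) (𝓝 1) := by
    have h : Continuous fun ε : ℝ => Real.exp (ε * y.1 k) := by fun_prop
    simpa using (h.tendsto 0).mono_left nhdsWithin_le_nhds
  have h : Tendsto (fun ε : ℝ => 1 + (2 * (Real.sinh (ε * (y.1 k / 2)) / ε) ^ 2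
      + 1 / 2 * y.2 k ^ 2 * Real.exp (ε * y.1 k))) (𝓝[>] 0)
      (𝓝 (1 + (2 * (y.1 k / 2) ^ 2 + 1 / 2 * y.2 k ^ 2 * 1))) :=
    (((hs.pow 2).const_mul 2).add (he.const_mul _)).const_add 1
  have e : 1 + (2 * (y.1 k / 2) ^ 2 + 1 / 2 * y.2 k ^ 2 * 1)
      = 1 + (y.1 k ^ 2 + y.2 k ^ 2) / 2 := by ring
  rw [e] at h
  refine h.congr' ?_
  filter_upwards [self_mem_nhdsWithin] with ε hε
  have hε0 : ε ≠ 0 := ne_of_gt hε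
  have hc : Real.cosh (ε * y.1 k) = 1 + 2 * Real.sinh (ε * (y.1 k / 2)) ^ 2 := by
    rw [cosh_eq_one_add_sinh_sq, mul_div_assoc]
  simp only [scaledBody, zBody, Prod.smul_fst, Prod.smul_snd, Pi.smul_apply, smul_eq_mul, hc]
  field_simp
  ring

/-- The rescaled cutoffs are supported in a fixed ball. -/
theorem norm_le_of_scaledBody_le [Fintype Λ] {ε : ℝ} (hε : 0 < ε) (hε1 : ε ≤ 1) {y : Config Λ}
    (h : ∀ k, scaledBody ε y k ≤ 3) : ‖y‖ ≤ 5 := by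
  have hb : ∀ k, zBody k (ε • y) - 1 ≤ 2 * ε ^ 2 := fun k => by
    have h1 := h k
    rw [scaledBody] at h1
    have h2 : (zBody k (ε • y) - 1) / ε ^ 2 ≤ 2 := by linarith
    rwa [div_le_iff₀ (by positivity)] at h2
  refine norm_prod_le_iff.2 ⟨(pi_norm_le_iff_of_nonneg (by norm_num)).2 fun k => ?_,
    (pi_norm_le_iff_of_nonneg (by norm_num)).2 fun k => ?_⟩
  · have h1 : 1 + (ε * y.1 k) ^ 2 / 2 ≤ Real.cosh (ε * y.1 k) := one_add_sq_div_two_le_cosh _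
    have h2 : Real.cosh (ε * y.1 k) ≤ zBody k (ε • y) := cosh_le_zBody k (ε • y)
    have h3 : ε ^ 2 * y.1 k ^ 2 ≤ ε ^ 2 * 4 := by nlinarith [hb k]
    have h4 := le_of_mul_le_mul_left h3 (by positivity)
    exact abs_le_of_sq_le_sq (by linarith) (by norm_num)
  · have h1 : (ε * y.2 k) ^ 2 ≤ 4 * zBody k (ε • y) * (zBody k (ε • y) - 1) :=
      snd_sq_le_zBody_mul k (ε • y)
    have h2 := one_le_zBody k (ε • y)
    have h3 : zBody k (ε • y) ≤ 3 := by nlinarith [hb k]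
    have h4 : ε ^ 2 * y.2 k ^ 2 ≤ ε ^ 2 * 24 := by nlinarith [hb k]
    have h5 := le_of_mul_le_mul_left h4 (by positivity)
    exact abs_le_of_sq_le_sq (by linarith) (by norm_num)

variable [Fintype Λ] [DecidableEq Λ]

/-- The scaling `x = ε y` turns the factor `ε²` of the measure at each site into a factor of the
coefficients of the cutoff. -/
theorem superIntegral_cutoff_sq_eq {ε : ℝ} (hε : 0 < ε) (F : Superfunction Λ) :
    superIntegral (fun x => (cutoff (fun _ => ε ^ 2) x : Grassmann Λ) * F x)
      = ∫ y : Config Λ, density (ε • y) * berezin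
        ((pairProd (fun k => ε ^ 2 * chi 1 (scaledBody ε y k))
          (fun k => deriv (chi 1) (scaledBody ε y k) * Real.exp (ε * y.1 k)) : Grassmann Λ)
            * F (ε • y)) := by
  have hrank : Module.finrank ℝ (Config Λ) = 2 * Fintype.card Λ := by
    simp [two_mul]
  have hpos : 0 < ε ^ (2 * Fintype.card Λ) := by positivity
  have hscale := Measure.integral_comp_smul (volume : Measure (Config Λ))
    (fun x => density x * berezin ((cutoff (fun _ => ε ^ 2) x : Grassmann Λ) * F x)) ε
  rw [hrank, abs_of_pos (inv_pos.2 hpos), smul_eq_mul] at hscale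
  rw [superIntegral_eq, ← mul_inv_cancel_left₀ hpos.ne' (∫ x, density x * _), ← hscale,
    ← integral_const_mul]
  refine integral_congr_ae (Eventually.of_forall fun y => ?_)
  have hprod : pairProd (fun k => ε ^ 2 * chi 1 (scaledBody ε y k))
      (fun k => deriv (chi 1) (scaledBody ε y k) * Real.exp (ε * y.1 k))
      = ε ^ (2 * Fintype.card Λ) • cutoff (fun _ => ε ^ 2) (ε • y) := by
    rw [cutoff_eq_pairProd, pairProd, pairProd, pow_mul, ← Finset.card_univ, ← Finset.prod_const,
      ← Finset.prod_smul]
    refine Finset.prod_congr rfl fun k _ => ?_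
    rw [deriv_chi (ε ^ 2), chi_eq_chi_one (ε ^ 2), smul_add, smul_smul,
      Algebra.algebraMap_eq_smul_one, Algebra.algebraMap_eq_smul_one, smul_smul]
    have hd : ε ^ 2 * (deriv (chi 1) (1 + (zBody k (ε • y) - 1) / ε ^ 2) / ε ^ 2
        * Real.exp ((ε • y).1 k))
        = deriv (chi 1) (scaledBody ε y k) * Real.exp (ε * y.1 k) := by
      rw [scaledBody, Prod.smul_fst, Pi.smul_apply, smul_eq_mul]
      field_simp
    rw [hd]
    rfl
  simp only [hprod, coe_smul_mul, map_smul, smul_eq_mul]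
  ring

/-- In the limit of small cutoffs the Berezin integral localizes at the zero field. -/
theorem tendsto_superIntegral_cutoff_zero {F : Superfunction Λ} (hF : IsSmooth F) :
    Tendsto (fun ε : ℝ => superIntegral
      (fun x => (cutoff (fun _ => ε ^ 2) x : Grassmann Λ) * F x)) (𝓝[>] 0) (𝓝 (body (F 0))) := by
  obtain ⟨B, hB0, hB⟩ := exists_bound_deriv_chi
  have hlimit : ∫ y : Config Λ, density (0 : Config Λ) * berezin
      ((pairProd (fun _ => 0) (fun k => deriv (chi 1) (1 + (y.1 k ^ 2 + y.2 k ^ 2) / 2))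
        : Grassmann Λ) * F 0) = body (F 0) := by
    have h : ∀ y : Config Λ, density (0 : Config Λ) * berezin
        ((pairProd (fun _ => 0) (fun k => deriv (chi 1) (1 + (y.1 k ^ 2 + y.2 k ^ 2) / 2))
          : Grassmann Λ) * F 0)
        = ((∏ _k : Λ, (2 * Real.pi)⁻¹) *
          ∏ k, deriv (chi 1) (1 + (y.1 k ^ 2 + y.2 k ^ 2) / 2))
            * ((-1) ^ Fintype.card Λ * body (F 0)) := fun y => by
      have hp : pairProd (fun _ => 0)
          (fun k => deriv (chi 1) (1 + (y.1 k ^ 2 + y.2 k ^ 2) / 2))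
          = (∏ k, deriv (chi 1) (1 + (y.1 k ^ 2 + y.2 k ^ 2) / 2)) • ∏ k : Λ, nu k := by
        simp only [pairProd, map_zero, add_zero, Finset.prod_smul]
      rw [hp, coe_smul_mul, map_smul, berezin_prod_nu_mul, density_eq, smul_eq_mul]
      simp
      ring
    simp_rw [h]
    rw [integral_mul_const, integral_prod_deriv_chi, ← mul_assoc, ← pow_add, ← two_mul,
      (even_two_mul _).neg_one_pow, one_mul]
  rw [← hlimit]
  have hev : ∀ᶠ ε : ℝ in 𝓝[>] 0, 0 < ε ∧ ε ≤ 1 := by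
    filter_upwards [Ioc_mem_nhdsGT (zero_lt_one (α := ℝ))] with ε hε using hε
  refine Tendsto.congr' (hev.mono fun ε hε => (superIntegral_cutoff_sq_eq hε.1 F).symm) ?_
  -- All coefficients are bounded on the ball of radius `5`, outside of which the cutoff vanishes.
  set D : ℝ := B * Real.exp 5 with hD
  have hbound : Continuous fun x : Config Λ => density x * pairBound D berezin (F x) := by
    refine contDiff_density.continuous.mul (continuous_finsetSum _ fun A _ => ?_)
    exact continuous_const.mul (hF.contDiff (berezin ∘ₗ
      LinearMap.mulLeft ℝ ((∏ k ∈ A, nu k : evenPart Λ) : Grassmann Λ))).continuous.abs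
  obtain ⟨M, hM⟩ := (isCompact_closedBall (0 : Config Λ) 5).exists_bound_of_continuousOn
    hbound.continuousOn
  have hcontBody : ∀ (ε : ℝ) (k : Λ), Continuous fun y : Config Λ => scaledBody ε y k :=
    fun ε k => by
      have := (contDiff_zBody k).continuous
      unfold scaledBody
      fun_prop
  refine tendsto_integral_filter_of_dominated_convergence
    ((Metric.closedBall (0 : Config Λ) 5).indicator fun _ => M) ?_ ?_ ?_ ?_
  · refine Eventually.of_forall fun ε => Continuous.aestronglyMeasurable ?_
    have hsm : Continuous fun y : Config Λ => ε • y := continuous_const_smul ε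
    refine (contDiff_density.continuous.comp hsm).mul ?_
    simp_rw [apply_pairProd_mul]
    refine continuous_finsetSum _ fun A _ => (Continuous.mul ?_ ?_).mul ?_
    · refine continuous_finsetProd _ fun k _ => ?_
      exact ((continuous_deriv_chi 1).comp (hcontBody ε k)).mul (by fun_prop)
    · refine continuous_finsetProd _ fun k _ => ?_
      exact continuous_const.mul ((contDiff_chi 1).continuous.comp (hcontBody ε k))
    · exact (hF.contDiff (berezin ∘ₗ LinearMap.mulLeft ℝ
        ((∏ k ∈ A, nu k : evenPart Λ) : Grassmann Λ))).continuous.comp hsm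
  · filter_upwards [hev] with ε hε
    refine Eventually.of_forall fun y => ?_
    by_cases hy : ∀ k, scaledBody ε y k ≤ 3
    · have hn := norm_le_of_scaledBody_le hε.1 hε.2 hy
      have hyε : ‖ε • y‖ ≤ 5 := by
        rw [norm_smul, Real.norm_eq_abs, abs_of_pos hε.1]
        nlinarith [norm_nonneg y, hε.2, hε.1]
      rw [Set.indicator_of_mem (mem_closedBall_zero_iff.2 hn), norm_mul, Real.norm_eq_abs,
        Real.norm_eq_abs, abs_of_pos (density_pos _)]
      refine le_trans (mul_le_mul_of_nonneg_left (abs_apply_pairProd_mul_le (D := D) (fun k => ?_)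
        (fun k => ?_) _ _) (density_pos _).le)
        ((le_abs_self _).trans (hM _ (mem_closedBall_zero_iff.2 hyε)))
      · rw [abs_mul, abs_of_nonneg (sq_nonneg ε)]
        exact mul_le_one₀ (pow_le_one₀ hε.1.le hε.2) (abs_nonneg _) (abs_chi_le_one _ _)
      · rw [abs_mul, abs_of_pos (Real.exp_pos _)]
        refine mul_le_mul (hB _) (Real.exp_le_exp.2 ?_) (Real.exp_pos _).le hB0
        have h1 : |(ε • y).1 k| ≤ 5 := ((norm_le_pi_norm (ε • y).1 k).trans
          (norm_fst_le (ε • y))).trans hyε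
        exact (le_abs_self _).trans h1
    · obtain ⟨k, hk⟩ := not_forall.1 hy
      have hk3 : 1 + 2 * (1 : ℝ) < scaledBody ε y k := by linarith [not_le.1 hk]
      have hz : pairProd (fun k => ε ^ 2 * chi 1 (scaledBody ε y k))
          (fun k => deriv (chi 1) (scaledBody ε y k) * Real.exp (ε * y.1 k)) = 0 :=
        Finset.prod_eq_zero (Finset.mem_univ k) (by
          beta_reduce
          rw [chi_eq_zero one_pos hk3.le, deriv_chi_eq_zero_of_gt one_pos hk3, zero_mul, mul_zero,
            zero_smul, map_zero, add_zero])
      rw [hz, ZeroMemClass.coe_zero, zero_mul, map_zero, mul_zero, norm_zero]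
      refine Set.indicator_nonneg (fun x hx => (norm_nonneg _).trans (hM x hx)) y
  · exact (integrable_indicator_iff measurableSet_closedBall).2
      (integrableOn_const (measure_closedBall_lt_top.ne))
  · refine Eventually.of_forall fun y => ?_
    have hid : Tendsto (fun ε : ℝ => ε) (𝓝[>] 0) (𝓝 0) := nhdsWithin_le_nhds
    have hsm : Tendsto (fun ε : ℝ => ε • y) (𝓝[>] 0) (𝓝 (0 : Config Λ)) := by
      simpa using hid.smul_const y
    have hexp : ∀ k, Tendsto (fun ε : ℝ => Real.exp (ε * y.1 k)) (𝓝[>] 0) (𝓝 1) := fun k => by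
      have h : Continuous fun ε : ℝ => Real.exp (ε * y.1 k) := by fun_prop
      simpa using (h.tendsto 0).mono_left nhdsWithin_le_nhds
    simp_rw [apply_pairProd_mul]
    refine ((contDiff_density.continuous.tendsto 0).comp hsm).mul
      (tendsto_finsetSum _ fun A _ => (Tendsto.mul ?_ ?_).mul ?_)
    · refine tendsto_finsetProd _ fun k _ => ?_
      have h := (((continuous_deriv_chi 1).tendsto _).comp (tendsto_scaledBody y k)).mul (hexp k)
      rw [mul_one] at h
      exact h
    · refine tendsto_finsetProd _ fun k _ => ?_
      have h := (hid.pow 2).mul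
        (((contDiff_chi 1).continuous.tendsto _).comp (tendsto_scaledBody y k))
      rw [zero_pow two_ne_zero, zero_mul] at h
      exact h
    · exact ((hF.contDiff (berezin ∘ₗ LinearMap.mulLeft ℝ
        ((∏ k ∈ A, nu k : evenPart Λ) : Grassmann Λ))).continuous.tendsto 0).comp hsm

/-- The localization principle. -/
theorem superIntegral_eq_body {F : Superfunction Λ} (hF : IsSmooth F) (hi : IsIntegrable F)
    (hQ : Q F = 0) : superIntegral F = body (F 0) := by
  have h1 : ∀ {R : ℝ}, 0 < R → superIntegral (fun x => (cutoff (fun _ => R) x : Grassmann Λ) * F x)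
      = superIntegral (fun x => (cutoff (fun _ => 1) x : Grassmann Λ) * F x) :=
    fun hR => superIntegral_cutoff_const hF hQ hR one_pos
  have h2 := tendsto_nhds_unique (tendsto_superIntegral_cutoff_atTop hF hi)
    (tendsto_const_nhds.congr' ((eventually_gt_atTop 0).mono fun R hR => (h1 hR).symm))
  have h3 := tendsto_nhds_unique (tendsto_superIntegral_cutoff_zero hF)
    (tendsto_const_nhds.congr' (eventually_mem_nhdsWithin.mono fun ε hε =>
      (h1 (pow_pos hε 2)).symm))
  rw [h2, h3]

end Localization

/-! ### Growth and integrability -/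

section Growth

variable {Λ : Type*}

theorem pow_mul_exp_neg_le {c : ℝ} (hc : 0 < c) (N : ℕ) {u : ℝ} (hu : 0 ≤ u) :
    u ^ N * Real.exp (-(c * (u - 1))) ≤ N.factorial / c ^ N * Real.exp c := by
  have h1 := Real.pow_div_factorial_le_exp (c * u) (mul_nonneg hc.le hu) N
  have h2 : Real.exp (-(c * (u - 1))) = Real.exp c / Real.exp (c * u) := by
    rw [← Real.exp_sub]
    ring_nf
  have h3 : u ^ N ≤ N.factorial / c ^ N * Real.exp (c * u) := by
    rw [mul_pow, div_le_iff₀ (by positivity)] at h1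
    rw [div_mul_eq_mul_div, le_div_iff₀ (by positivity)]
    linarith
  rw [h2, mul_div_assoc', div_le_iff₀ (Real.exp_pos _)]
  nlinarith [Real.exp_pos c]

/-- At each site, `e^{-c (z - 1)}` beats every power of the body of `z`, and hence every power of
`e^{±t}`, `t` and `s`. -/
theorem exists_site_bound {c : ℝ} (hc : 0 < c) (M : ℕ) : ∃ K : ℝ, ∀ (k : Λ) (x : Config Λ),
    (2 * Real.pi)⁻¹ * Real.exp (-x.1 k) * (zBody k x ^ M * Real.exp (-(c * (zBody k x - 1))))
      ≤ K * ((1 + x.1 k ^ 2)⁻¹ * (1 + x.2 k ^ 2)⁻¹) := by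
  refine ⟨50 * ((M + 5).factorial / c ^ (M + 5) * Real.exp c), fun k x => ?_⟩
  set b := zBody k x with hb
  have hb1 : 1 ≤ b := one_le_zBody k x
  have hpi : (2 * Real.pi)⁻¹ ≤ 1 := inv_le_one_of_one_le₀ (by linarith [Real.pi_gt_three])
  have ht : 1 + x.1 k ^ 2 ≤ 5 * b ^ 2 := by
    have h := sq_le_sq' (by linarith [neg_abs_le (x.1 k), abs_fst_le_zBody k x])
      ((le_abs_self _).trans (abs_fst_le_zBody k x))
    nlinarith
  have hs : 1 + x.2 k ^ 2 ≤ 5 * b ^ 2 := by nlinarith [snd_sq_le_zBody k x]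
  have he : (2 * Real.pi)⁻¹ * Real.exp (-x.1 k) ≤ 2 * b := by
    have h := exp_neg_le_zBody k x
    have := mul_le_mul hpi h (Real.exp_pos _).le zero_le_one
    linarith
  have hmain := pow_mul_exp_neg_le hc (M + 5) (zero_le_one.trans hb1)
  set E := Real.exp (-(c * (b - 1)))
  have hE : 0 < E := Real.exp_pos _
  rw [← mul_inv, ← div_eq_mul_inv, le_div_iff₀ (by positivity)]
  calc (2 * Real.pi)⁻¹ * Real.exp (-x.1 k) * (b ^ M * E) * ((1 + x.1 k ^ 2) * (1 + x.2 k ^ 2))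
      ≤ 2 * b * (b ^ M * E) * (5 * b ^ 2 * (5 * b ^ 2)) := by
        gcongr
    _ = 50 * (b ^ (M + 5) * E) := by ring
    _ ≤ 50 * ((M + 5).factorial / c ^ (M + 5) * Real.exp c) := by gcongr

variable [Fintype Λ]

/-- A function of the configuration has moderate growth if it is bounded by a constant multiple
of a power of the product of the bodies of all `z_k`. -/
def IsModerate (f : Config Λ → ℝ) : Prop := ∃ M : ℕ, f =O[⊤] fun x => (∏ k, zBody k x) ^ M

theorem one_le_prod_zBody (x : Config Λ) : 1 ≤ ∏ k, zBody k x :=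
  Finset.one_le_prod fun k _ => one_le_zBody k x

theorem zBody_le_prod (k : Λ) (x : Config Λ) : zBody k x ≤ ∏ k, zBody k x := by
  classical
  rw [← Finset.mul_prod_erase _ _ (Finset.mem_univ k)]
  exact le_mul_of_one_le_right (zero_le_one.trans (one_le_zBody k x))
    (Finset.one_le_prod fun i _ => one_le_zBody i x)

theorem isBigO_prod_zBody_pow {M N : ℕ} (h : M ≤ N) :
    (fun x : Config Λ => (∏ k, zBody k x) ^ M) =O[⊤] fun x => (∏ k, zBody k x) ^ N :=
  isBigO_top.2 ⟨1, fun x => by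
    have h1 := one_le_prod_zBody x
    rw [one_mul, Real.norm_of_nonneg (by positivity), Real.norm_of_nonneg (by positivity)]
    exact pow_le_pow_right₀ h1 h⟩

theorem isModerate_const (c : ℝ) : IsModerate (fun _ : Config Λ => c) :=
  ⟨0, by simpa using isBigO_const_const c (one_ne_zero (α := ℝ)) ⊤⟩

theorem IsModerate.add {f g : Config Λ → ℝ} (hf : IsModerate f) (hg : IsModerate g) :
    IsModerate fun x => f x + g x := by
  obtain ⟨M, hM⟩ := hf
  obtain ⟨N, hN⟩ := hg
  exact ⟨max M N, (hM.trans (isBigO_prod_zBody_pow (le_max_left M N))).add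
    (hN.trans (isBigO_prod_zBody_pow (le_max_right M N)))⟩

theorem IsModerate.mul {f g : Config Λ → ℝ} (hf : IsModerate f) (hg : IsModerate g) :
    IsModerate fun x => f x * g x := by
  obtain ⟨M, hM⟩ := hf
  obtain ⟨N, hN⟩ := hg
  exact ⟨M + N, by simpa only [pow_add] using hM.mul hN⟩

theorem IsModerate.sum {ι : Type*} {A : Finset ι} {f : ι → Config Λ → ℝ}
    (hf : ∀ i ∈ A, IsModerate (f i)) : IsModerate fun x => ∑ i ∈ A, f i x := by
  classical
  induction A using Finset.induction_on with
  | empty => simpa using isModerate_const (Λ := Λ) 0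
  | insert i A hi ih =>
    simp_rw [Finset.sum_insert hi]
    exact (hf i (Finset.mem_insert_self i A)).add
      (ih fun j hj => hf j (Finset.mem_insert_of_mem hj))

theorem isModerate_exp (k : Λ) : IsModerate fun x : Config Λ => Real.exp (x.1 k) :=
  ⟨1, isBigO_top.2 ⟨2, fun x => by
    have h := zBody_le_prod k x
    have h1 := one_le_prod_zBody x
    rw [pow_one, Real.norm_of_nonneg (Real.exp_pos _).le, Real.norm_of_nonneg (by positivity)]
    exact (exp_le_zBody k x).trans (by linarith)⟩⟩

/-- A superfunction has moderate growth if all its coefficients do. -/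
def IsModerateSuper (F : Superfunction Λ) : Prop :=
  ∀ l : Grassmann Λ →ₗ[ℝ] ℝ, IsModerate fun x => l (F x)

theorem IsModerateSuper.mul {F G : Superfunction Λ} (hF : IsModerateSuper F)
    (hG : IsModerateSuper G) : IsModerateSuper (F * G) := fun l => by
  have h : (fun x => l ((F * G) x)) = _ := funext fun x => apply_mul_eq_sum l (F x) (G x)
  rw [h]
  exact IsModerate.sum fun I _ => IsModerate.sum fun J _ =>
    ((hF _).mul (hG _)).mul (isModerate_const _)

theorem IsModerateSuper.prod {ι : Type*} {A : Finset ι} {H : ι → Config Λ → evenPart Λ}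
    (hH : ∀ i ∈ A, IsModerateSuper fun x => (H i x : Grassmann Λ)) :
    IsModerateSuper fun x => ((∏ i ∈ A, H i x : evenPart Λ) : Grassmann Λ) := by
  classical
  induction A using Finset.induction_on with
  | empty =>
    simp_rw [Finset.prod_empty]
    exact fun l => isModerate_const _
  | insert i A hi ih =>
    simp_rw [Finset.prod_insert hi]
    exact (hH i (Finset.mem_insert_self i A)).mul
      (ih fun j hj => hH j (Finset.mem_insert_of_mem hj))

theorem integrable_prod_inv_one_add_sq :
    Integrable fun x : Config Λ => ∏ k, ((1 + x.1 k ^ 2)⁻¹ * (1 + x.2 k ^ 2)⁻¹) := by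
  simp_rw [Finset.prod_mul_distrib]
  have h : Integrable (fun v : Λ → ℝ => ∏ k, (1 + v k ^ 2)⁻¹) :=
    Integrable.fintype_prod (f := fun _ u => (1 + u ^ 2)⁻¹) fun _ => integrable_inv_one_add_sq
  exact h.mul_prod h

theorem isIntegrable_of_isModerate {P : Superfunction Λ} (hP : IsModerateSuper P)
    {B : Config Λ → ℝ} {ε : Λ → ℝ} (hε : ∀ k, 0 < ε k)
    (hB : ∀ x, ∑ k, ε k * (zBody k x - 1) ≤ B x)
    (hs : IsSmooth fun x => Real.exp (-B x) • P x) :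
    IsIntegrable fun x => Real.exp (-B x) • P x := fun I => by
  obtain ⟨M, hM⟩ := hP (monomialBasis.coord I)
  obtain ⟨C, hC⟩ := isBigO_top.1 hM
  choose K hK using fun k => exists_site_bound (Λ := Λ) (hε k) M
  have hC0 : 0 ≤ |C| := abs_nonneg C
  refine ((integrable_prod_inv_one_add_sq (Λ := Λ)).const_mul (|C| * ∏ k, K k)).mono'
    (contDiff_density.mul (hs I)).continuous.aestronglyMeasurable
    (Eventually.of_forall fun x => ?_)
  have hw : ‖(∏ k, zBody k x) ^ M‖ = ∏ k, zBody k x ^ M := by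
    rw [Real.norm_of_nonneg (pow_nonneg (zero_le_one.trans (one_le_prod_zBody x)) M),
      Finset.prod_pow]
  have h1 : |monomialBasis.coord I (P x)| ≤ |C| * ∏ k, zBody k x ^ M := by
    refine (hC x).trans ?_
    rw [hw]
    exact mul_le_mul_of_nonneg_right (le_abs_self C) (Finset.prod_nonneg fun k _ =>
      pow_nonneg (zero_le_one.trans (one_le_zBody k x)) M)
  have h2 : Real.exp (-B x) ≤ ∏ k, Real.exp (-(ε k * (zBody k x - 1))) := by
    rw [← Real.exp_sum, Finset.sum_neg_distrib]
    exact Real.exp_le_exp.2 (neg_le_neg (hB x))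
  have h3 : coeff (fun x => Real.exp (-B x) • P x) I x
      = Real.exp (-B x) * monomialBasis.coord I (P x) :=
    map_smul (monomialBasis.coord I) _ _
  rw [h3, Real.norm_eq_abs, abs_mul, abs_mul, abs_of_pos (density_pos x),
    abs_of_pos (Real.exp_pos _)]
  calc density x * (Real.exp (-B x) * |monomialBasis.coord I (P x)|)
      ≤ density x * ((∏ k, Real.exp (-(ε k * (zBody k x - 1)))) *
          (|C| * ∏ k, zBody k x ^ M)) := by
        refine mul_le_mul_of_nonneg_left (mul_le_mul h2 h1 (abs_nonneg _) ?_) (density_pos x).le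
        exact Finset.prod_nonneg fun k _ => (Real.exp_pos _).le
    _ = |C| * ∏ k, ((2 * Real.pi)⁻¹ * Real.exp (-x.1 k) *
          (zBody k x ^ M * Real.exp (-(ε k * (zBody k x - 1))))) := by
        simp only [density, Finset.prod_mul_distrib]
        ring
    _ ≤ |C| * ∏ k, (K k * ((1 + x.1 k ^ 2)⁻¹ * (1 + x.2 k ^ 2)⁻¹)) := by
        refine mul_le_mul_of_nonneg_left (Finset.prod_le_prod (fun k _ => ?_)
          fun k _ => hK k k x) hC0
        have := one_le_zBody k x
        positivity
    _ = |C| * (∏ k, K k) * ∏ k, ((1 + x.1 k ^ 2)⁻¹ * (1 + x.2 k ^ 2)⁻¹) := by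
        rw [Finset.prod_mul_distrib, mul_assoc]

end Growth

/-! ### The partition function -/

section Exponential

variable {Λ : Type*}

theorem exp_of_sq_eq_zero {a : Grassmann Λ} (ha : a * a = 0) : IsNilpotent.exp a = 1 + a := by
  have h : a ^ 2 = 0 := by rw [sq, ha]
  rw [IsNilpotent.exp_eq_sum h, Finset.sum_range_succ, Finset.sum_range_one]
  simp

theorem exp_sum_of_sq_eq_zero {ι : Type*} (A : Finset ι) {m : ι → evenPart Λ}
    (hm : ∀ i, m i * m i = 0) :
    IsNilpotent (∑ i ∈ A, (m i : Grassmann Λ)) ∧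
      IsNilpotent.exp (∑ i ∈ A, (m i : Grassmann Λ))
        = ((∏ i ∈ A, (1 + m i) : evenPart Λ) : Grassmann Λ) := by
  classical
  have hm' : ∀ i, (m i : Grassmann Λ) * m i = 0 := fun i => congrArg Subtype.val (hm i)
  induction A using Finset.induction_on with
  | empty => simp
  | insert i A hi ih =>
    have hc : Commute (m i : Grassmann Λ) (∑ i ∈ A, (m i : Grassmann Λ)) :=
      even_coe_comm (m i) _
    have hn : IsNilpotent (m i : Grassmann Λ) := ⟨2, by rw [sq, hm']⟩
    rw [Finset.sum_insert hi, Finset.prod_insert hi]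
    refine ⟨hc.isNilpotent_add hn ih.1, ?_⟩
    rw [IsNilpotent.exp_add_of_commute hc hn ih.1, ih.2, exp_of_sq_eq_zero (hm' i)]
    rfl

/-- The exponential of a linear combination of superfunctions `b + n` whose nilpotent parts have
square zero is the product of the exponentials. -/
theorem superExp_neg_sum {ι : Type*} (A : Finset ι) (c : ι → ℝ) (b : ι → Config Λ → ℝ)
    (n : ι → Config Λ → evenPart Λ) (hsq : ∀ i x, n i x * n i x = 0)
    (hbody : ∀ i x, body (n i x : Grassmann Λ) = 0) (x : Config Λ) :
    superExp (fun x => -∑ i ∈ A, c i • (algebraMap ℝ (Grassmann Λ) (b i x) + n i x - 1)) x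
      = Real.exp (-∑ i ∈ A, c i * (b i x - 1)) •
        ((∏ i ∈ A, (1 + -(c i • n i x)) : evenPart Λ) : Grassmann Λ) := by
  have hsum : -∑ i ∈ A, c i • (algebraMap ℝ (Grassmann Λ) (b i x) + n i x - 1)
      = algebraMap ℝ (Grassmann Λ) (-∑ i ∈ A, c i * (b i x - 1))
        + ∑ i ∈ A, ((-(c i • n i x) : evenPart Λ) : Grassmann Λ) := by
    rw [map_neg, map_sum, ← Finset.sum_neg_distrib, ← Finset.sum_neg_distrib,
      ← Finset.sum_add_distrib]
    refine Finset.sum_congr rfl fun i _ => ?_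
    rw [NegMemClass.coe_neg, Algebra.algebraMap_eq_smul_one, Algebra.algebraMap_eq_smul_one]
    change _ = _ + -(c i • (n i x : Grassmann Λ))
    module
  have hb : body (-∑ i ∈ A, c i • (algebraMap ℝ (Grassmann Λ) (b i x) + n i x - 1))
      = -∑ i ∈ A, c i * (b i x - 1) := by
    rw [hsum, body_add, body_algebraMap]
    change _ + bodyL _ = _
    refine add_eq_left.2 ?_
    rw [map_sum]
    refine Finset.sum_eq_zero fun i _ => ?_
    rw [NegMemClass.coe_neg, map_neg, neg_eq_zero]
    change body (c i • (n i x : Grassmann Λ)) = 0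
    rw [body_smul, hbody, mul_zero]
  have hsq' : ∀ i, -(c i • n i x) * -(c i • n i x) = 0 := fun i => by
    rw [neg_mul_neg, smul_mul_smul_comm, hsq, smul_zero]
  rw [superExp, hb, hsum, add_sub_cancel_left, (exp_sum_of_sq_eq_zero A hsq').2]

end Exponential

section PartitionFunction

variable {Λ : Type*}

/-- The body of `S_ij`. -/
def sBody (i j : Λ) (x : Config Λ) : ℝ :=
  Real.cosh (x.1 i - x.1 j) + 1 / 2 * (x.2 i - x.2 j) ^ 2 * Real.exp (x.1 i + x.1 j)

/-- The bodies of the terms of the action: of `S_e` for an unordered pair `e`, and of `z_k` for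
a site `k`. -/
def termBody : Sym2 Λ ⊕ Λ → Config Λ → ℝ :=
  Sum.elim (fun e => sBody (Quot.out e).1 (Quot.out e).2) zBody

theorem one_le_termBody (i : Sym2 Λ ⊕ Λ) (x : Config Λ) : 1 ≤ termBody i x := by
  rcases i with e | k
  · have h1 := Real.one_le_cosh (x.1 (Quot.out e).1 - x.1 (Quot.out e).2)
    have h2 : 0 ≤ 1 / 2 * (x.2 (Quot.out e).1 - x.2 (Quot.out e).2) ^ 2
        * Real.exp (x.1 (Quot.out e).1 + x.1 (Quot.out e).2) := by positivity
    change 1 ≤ sBody _ _ x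
    unfold sBody
    linarith
  · exact one_le_zBody k x

theorem termBody_zero (i : Sym2 Λ ⊕ Λ) : termBody i (0 : Config Λ) = 1 := by
  rcases i with e | k <;> simp [termBody, sBody, zBody]

theorem contDiff_termBody [Fintype Λ] (i : Sym2 Λ ⊕ Λ) : ContDiff ℝ ∞ (termBody i) := by
  rcases i with e | k
  · change ContDiff ℝ ∞ (sBody _ _)
    unfold sBody
    fun_prop
  · exact contDiff_zBody k

variable [DecidableEq Λ]

/-- The nilpotent part of `S_ij`. -/
def sNil (i j : Λ) (x : Config Λ) : evenPart Λ :=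
  Real.exp (x.1 i + x.1 j) • bilin (Pi.single (Sum.inl i) 1 - Pi.single (Sum.inl j) 1)
    (Pi.single (Sum.inr i) 1 - Pi.single (Sum.inr j) 1)

theorem S_apply (i j : Λ) (x : Config Λ) :
    S i j x = algebraMap ℝ (Grassmann Λ) (sBody i j x) + sNil i j x := by
  rw [S, psiBar, psiBar, psi, psi, ← map_sub, ← map_sub]
  rfl

theorem edgeS_eq (e : Sym2 Λ) : edgeS e = S (Quot.out e).1 (Quot.out e).2 := by
  conv_lhs => rw [← Quot.out_eq e]
  rfl

/-- The nilpotent parts of the terms of the action. -/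
def termNil : Sym2 Λ ⊕ Λ → Config Λ → evenPart Λ :=
  Sum.elim (fun e => sNil (Quot.out e).1 (Quot.out e).2) zNil

theorem termNil_mul_self (i : Sym2 Λ ⊕ Λ) (x : Config Λ) : termNil i x * termNil i x = 0 := by
  rcases i with e | k
  · change sNil _ _ x * sNil _ _ x = 0
    rw [sNil, smul_mul_smul_comm, bilin_mul_self, smul_zero]
  · exact zNil_mul_self k x

theorem body_termNil (i : Sym2 Λ ⊕ Λ) (x : Config Λ) :
    body (termNil i x : Grassmann Λ) = 0 := by
  rcases i with e | k <;>
    exact (body_smul _ _).trans (mul_eq_zero_of_right _ (body_bilin _ _))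

variable [Fintype Λ]

theorem isSmooth_termNil (i : Sym2 Λ ⊕ Λ) : IsSmooth fun x => (termNil i x : Grassmann Λ) := by
  rcases i with e | k <;> exact (isSmooth_const _).smul (by fun_prop)

theorem Q_term (i : Sym2 Λ ⊕ Λ) :
    Q (fun x => algebraMap ℝ (Grassmann Λ) (termBody i x) + termNil i x) = 0 := by
  rcases i with e | k
  · have h : (fun x => algebraMap ℝ (Grassmann Λ) (termBody (Sum.inl e) x) + termNil (Sum.inl e) x)
        = S (Quot.out e).1 (Quot.out e).2 := funext fun x => (S_apply _ _ x).symm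
    rw [h, Q_S]
  · exact Q_z k

theorem isModerateSuper_one_sub_termNil (c : ℝ) (i : Sym2 Λ ⊕ Λ) :
    IsModerateSuper fun x => ((1 + -(c • termNil i x) : evenPart Λ) : Grassmann Λ) := fun l => by
  have hform : ∀ (f : Config Λ → ℝ) (v w : Λ ⊕ Λ → ℝ), IsModerate f → IsModerate fun x =>
      l ((1 + -(c • f x • bilin v w) : evenPart Λ) : Grassmann Λ) := fun f v w hf => by
    have h : ∀ x, l ((1 + -(c • f x • bilin v w) : evenPart Λ) : Grassmann Λ)
        = l 1 + f x * (-c * l (bilin v w)) := fun x => by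
      have h' : ((1 + -(c • f x • bilin v w) : evenPart Λ) : Grassmann Λ)
          = 1 + -(c • f x • (bilin v w : Grassmann Λ)) := rfl
      rw [h', map_add, map_neg, map_smul, map_smul, smul_eq_mul, smul_eq_mul]
      ring
    simp_rw [h]
    exact (isModerate_const _).add (hf.mul (isModerate_const _))
  rcases i with e | k
  · refine hform (fun x => Real.exp (x.1 (Quot.out e).1 + x.1 (Quot.out e).2)) _ _ ?_
    simp_rw [Real.exp_add]
    exact (isModerate_exp _).mul (isModerate_exp _)
  · exact hform (fun x => Real.exp (x.1 k)) _ _ (isModerate_exp k)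

/-- The coefficients of the terms of the action. -/
def termCoeff (β : Sym2 Λ → ℝ) (ε : Λ → ℝ) : Sym2 Λ ⊕ Λ → ℝ := Sum.elim β ε

theorem neg_action_eq (G : SimpleGraph Λ) [DecidableRel G.Adj] (β : Sym2 Λ → ℝ) (ε : Λ → ℝ) :
    -action G β ε = fun x => -∑ i ∈ G.edgeFinset.disjSum Finset.univ, termCoeff β ε i •
      (algebraMap ℝ (Grassmann Λ) (termBody i x) + termNil i x - 1) := by
  funext x
  rw [Pi.neg_apply, action, Finset.sum_disjSum]
  congr 2
  refine Finset.sum_congr rfl fun e _ => ?_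
  rw [edgeS_eq, S_apply]
  rfl

theorem superExp_neg_action (G : SimpleGraph Λ) [DecidableRel G.Adj] (β : Sym2 Λ → ℝ)
    (ε : Λ → ℝ) : superExp (-action G β ε) = fun x =>
      Real.exp (-∑ i ∈ G.edgeFinset.disjSum Finset.univ, termCoeff β ε i * (termBody i x - 1)) •
        ((∏ i ∈ G.edgeFinset.disjSum Finset.univ, (1 + -(termCoeff β ε i • termNil i x))
          : evenPart Λ) : Grassmann Λ) := by
  rw [neg_action_eq]
  exact funext fun x => superExp_neg_sum _ _ _ _ termNil_mul_self body_termNil x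

/-- `e^{-A}` is a product of functions of the invariants `S_ij` and `z_k`. -/
theorem isInvariant_superExp_neg_action (G : SimpleGraph Λ) [DecidableRel G.Adj]
    (β : Sym2 Λ → ℝ) (ε : Λ → ℝ) : IsInvariant (superExp (-action G β ε)) := by
  have hfac : ∀ i x, taylor (fun u => Real.exp (-(termCoeff β ε i * (u - 1)))) (termBody i)
      (termNil i) x = Real.exp (-(termCoeff β ε i * (termBody i x - 1))) •
        (1 + -(termCoeff β ε i • termNil i x)) := fun i x => by
    have hd : deriv (fun u => Real.exp (-(termCoeff β ε i * (u - 1)))) (termBody i x)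
        = Real.exp (-(termCoeff β ε i * (termBody i x - 1))) * -termCoeff β ε i := by
      have h := ((((hasDerivAt_id (termBody i x)).sub_const 1).const_mul
        (termCoeff β ε i)).neg).exp
      rw [mul_one] at h
      exact h.deriv
    rw [taylor, hd, Algebra.algebraMap_eq_smul_one]
    module
  have hform : superExp (-action G β ε) = fun x =>
      ((∏ i ∈ G.edgeFinset.disjSum Finset.univ, taylor
        (fun u => Real.exp (-(termCoeff β ε i * (u - 1)))) (termBody i) (termNil i) x
          : evenPart Λ) : Grassmann Λ) := by
    rw [superExp_neg_action]
    funext x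
    simp_rw [hfac]
    rw [Finset.prod_smul, ← Real.exp_sum, Finset.sum_neg_distrib]
    rfl
  rw [hform]
  exact IsInvariant.prod fun i _ => isInvariant_taylor (by fun_prop) (contDiff_termBody i)
    (isSmooth_termNil i) (termNil_mul_self i) (Q_term i)

theorem isIntegrable_superExp_neg_action (G : SimpleGraph Λ) [DecidableRel G.Adj]
    {β : Sym2 Λ → ℝ} {ε : Λ → ℝ} (hβ : ∀ e ∈ G.edgeSet, 0 ≤ β e) (hε : ∀ k, 0 < ε k) :
    IsIntegrable (superExp (-action G β ε)) := by
  have hs := (isInvariant_superExp_neg_action G β ε).smooth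
  rw [superExp_neg_action] at hs ⊢
  refine isIntegrable_of_isModerate
    (IsModerateSuper.prod fun i _ => isModerateSuper_one_sub_termNil _ i) hε (fun x => ?_) hs
  rw [Finset.sum_disjSum]
  refine le_add_of_nonneg_left (Finset.sum_nonneg fun e he => mul_nonneg
    (hβ e (SimpleGraph.mem_edgeFinset.1 he)) ?_)
  linarith [one_le_termBody (Sum.inl e) x]

theorem body_superExp_neg_action_zero (G : SimpleGraph Λ) [DecidableRel G.Adj]
    (β : Sym2 Λ → ℝ) (ε : Λ → ℝ) : body (superExp (-action G β ε) 0) = 1 := by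
  rw [superExp_neg_action, body_smul, Finset.sum_eq_zero, neg_zero, Real.exp_zero, one_mul]
  · change (ExteriorAlgebra.algebraMapInv.comp (evenPart Λ).val) _ = 1
    rw [map_prod]
    refine Finset.prod_eq_one fun i _ => ?_
    have h : (ExteriorAlgebra.algebraMapInv.comp (evenPart Λ).val) (termNil i 0) = 0 :=
      body_termNil i 0
    rw [map_add, map_one, map_neg, map_smul, h, smul_zero, neg_zero, add_zero]
  · intro i _
    rw [termBody_zero, sub_self, mul_zero]

theorem partitionFunction_eq_one (G : SimpleGraph Λ) [DecidableRel G.Adj]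
    {β : Sym2 Λ → ℝ} {ε : Λ → ℝ} (hβ : ∀ e ∈ G.edgeSet, 0 ≤ β e) (hε : ∀ k, 0 < ε k) :
    partitionFunction G β ε = 1 := by
  have h := isInvariant_superExp_neg_action G β ε
  rw [partitionFunction, superIntegral_eq_body h.smooth
    (isIntegrable_superExp_neg_action G hβ hε) h.Q_eq_zero, body_superExp_neg_action_zero]

end PartitionFunction

end

end H22

theorem propositionC1 {Λ : Type*} [Fintype Λ] [DecidableEq Λ] :
    (∀ F : H22.Superfunction Λ, H22.IsSmooth F → H22.IsIntegrable F → H22.Q F = 0 →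
      H22.superIntegral F = H22.body (F 0)) ∧
    (∀ (G : SimpleGraph Λ) [DecidableRel G.Adj] (β ε : ℝ), 0 ≤ β → 0 < ε →
      H22.partitionFunction G (fun _ => β) (fun _ => ε) = 1) ∧
    (∀ (G : SimpleGraph Λ) [DecidableRel G.Adj] (β : Sym2 Λ → ℝ) (ε : Λ → ℝ),
      (∀ e ∈ G.edgeSet, 0 ≤ β e) → (∀ k, 0 < ε k) →
      H22.partitionFunction G β ε = 1) :=
  ⟨fun _ hF hi hQ => H22.superIntegral_eq_body hF hi hQ,
    fun G _ _ _ hβ hε => H22.partitionFunction_eq_one G (fun _ _ => hβ) fun _ => hε,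
    fun G _ _ _ hβ hε => H22.partitionFunction_eq_one G hβ hε⟩
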